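/- **Model.** A team of $n$ players plays, in each period $\tau=0,1,2,\dots$, at most one of two stage games $g\in\{G,B\}$ with actions $C$ (cooperate) and $N$. In game $g$ the payoffs $\pi_{i,g}(\mathbf a)$, $\mathbf a\in\{C,N\}^n$, satisfy: (1) $\pi_{i,g}(\mathbf a)=\pi_g(a_i,\mathbf a_{-i})$ depends only on $i$'s own action and, up to permutation, on the others' actions; (2) $\sum_i\pi_{i,g}$ is uniquely maximized at $C^n$; (3) $N$ is strictly dominant; (4) $\max_{a_i}\pi_g(a_i,\mathbf a_{-i})$ is minimized at $\mathbf a_{-i}=N^{n-1}$; (5) $\sum_i\pi_{i,g}$ is strictly larger at $N^n$ than at any profile other than $C^n$, $N^n$; (6) $\pi_g(N,\mathbf a_{-i})-\pi_g(C,\mathbf a_{-i})$ is smallest at $\mathbf a_{-i}=C^{n-1}$. A period without a game pays $0$. Put $c_g=\pi_g(C,C^{n-1})-\pi_g(N,N^{n-1})$ and $d_g=\pi_g(N,C^{n-1})-\pi_g(C,C^{n-1})$. Players discount by $\delta\in(0,1)$. There are two tasks $t_G,t_B$; in a period on task $t_g$ game $g$ arrives with probability $a_g\in(0,1]$ and the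 other game never does. Cooperation in $G$ has social value $V_G>0$ per occurrence, cooperation in $B$ has social value $V_B<0$. A fraction $q_g\ge 0$ of teams must be on task $t_g$, where $q_G+q_B=1$. A *static team structure* is a finitely supported probability measure $\lambda$ on assignments $\nu\in\Delta(\{t_G,t_B\})$ with a reshuffling rate $r_\nu\in[0,1]$ for each $\nu\in\operatorname{supp}\lambda$; a team with assignment $\nu$ draws its task from $\nu$ independently each period and has discount factor $(1-r_\nu)\delta$. It is feasible if $\sum_\nu\lambda(\nu)\nu(t_g)=q_g$ for $g=G,B$. A *reactive assignment* with memory $K\ge 1$ is a map $m:(\{t_G,t_B\}\times\{G,B,\emptyset\})^K\to\Delta(\{t_G,t_B\})$ that gives the distribution of the next task as a function of the tasks and games of the last $K$ periods (including the current one); it may use the games only through what the designer observes of them, which is given by an arbitrary fixed function of the game outcome in $\{G,B,\emptyset\}$ (so the designer may observe all arrivals, only those of $G$, or none). It induces a Markov chain on $(\{t_G,t_B\}\times\{G,B,\emptyset\})^K$. A *reactive team structure* is a finitely supported probability measure on reactive assignments with, for each $m$ in its support, a reshuffling rate $r_m\in[0,1]$ (discount factor $(1-r_m)\delta$) and a steady-state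 distribution $\overline m$ of the chain. It is feasible if the induced steady-state share of teams on task $t_g$ is $q_g$ for $g=G,B$. Each team plays a player-optimal subgame-perfect equilibrium, i.e. one that maximizes the sum of the players' expected discounted payoffs among all subgame-perfect equilibria in behavioral strategies; strategies depend on the team's history of states and actions and on the current state. For a static team, a state is the pair of current task and game; for a reactive team, it is the tasks and games of the last $K$ periods, and the initial state is distributed according to $\overline m$. There is cooperation in a state if such equilibria exist and in each of them all players cooperate with probability one whenever that state occurs on the equilibrium path. The social value of a structure is the steady-state mass, aggregated over teams, of states with cooperation in $G$, times $V_G$, plus that of states with cooperation in $B$, times $V_B$. A structure is optimal if it is feasible and its social value is at least that of every feasible structure of its class (static structures, respectively reactive structures with the given memory $K$ and the given observations). **Proposition.** Suppose that $d_G>\frac{\delta}{1-\delta}a_Gc_G$ and $\max\{d_G,d_B\}<\frac{\delta}{1-\delta}a_Bc_B$. Let $\nu^{coop}$ be the assignment with $$\max\{d_G,d_B\}=\frac{\delta}{1-\delta}\left(\nu^{coop}(t_G)a_Gc_G+(1-\nu^{coop}(t_G))a_Bc_B\right),$$ and suppose that for some $g\in\{G,B\}$ there is an optimal static team structure $\lambda$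 with $\lambda(\nu^{coop})>0$ and $\operatorname{supp}\lambda\subseteq\{\nu^{coop},\nu^g\}$, where $r_{\nu^{coop}}=0$, $\nu^g(t_g)=1$, and, if $\nu^g\in\operatorname{supp}\lambda$, $r_{\nu^g}$ is so high that there is no cooperation under $\nu^g$ (in every player-optimal equilibrium, no player cooperates on the equilibrium path). If $d_G\neq d_B$, then for every memory $K\ge1$ and every specification of what the designer observes of the games, optimal reactive team structures have strictly higher social value than optimal static ones: there is a feasible reactive team structure whose social value strictly exceeds that of every feasible static team structure, and hence the social value of any optimal reactive team structure is strictly higher than that of any optimal static team structure. -/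

import Mathlib

/-- The two kinds of games. -/
inductive Game
  | good
  | bad
  deriving DecidableEq

instance : Fintype Game := ⟨{Game.good, Game.bad}, fun x => by cases x <;> decide⟩

/-- The two actions: cooperate (`C`) or not (`N`). -/
inductive Move
  | C
  | N
  deriving DecidableEq

instance : Fintype Move := ⟨{Move.C, Move.N}, fun x => by cases x <;> decide⟩

/-- An `n`-player stage game: `π i a` is the payoff of player `i` at the action profile `a`. -/
structure StageGame (n : ℕ) where
  π : Fin n → (Fin n → Move) → ℝ
  /-- A payoff depends only on the own action and, up to permutation, on the others' actions. -/
  symmetric : ∀ (e : Equiv.Perm (Fin n)) (i : Fin n) (a : Fin n → Move),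
    π (e i) (a ∘ e.symm) = π i a
  /-- Aggregate payoffs are uniquely maximized by full cooperation. -/
  coop_max : ∀ a : Fin n → Move, a ≠ (fun _ => Move.C) →
    ∑ i, π i a < ∑ i, π i (fun _ => Move.C)
  /-- Not cooperating is strictly dominant. -/
  dominant : ∀ (i : Fin n) (a : Fin n → Move),
    π i (Function.update a i Move.C) < π i (Function.update a i Move.N)
  /-- The others hold a player to the lowest best-reply payoff by complete non-cooperation. -/
  minmax : ∀ (i : Fin n) (a : Fin n → Move),
    max (π i (Function.update (fun _ => Move.N) i Move.C))
        (π i (Function.update (fun _ => Move.N) i Move.N)) ≤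
      max (π i (Function.update a i Move.C)) (π i (Function.update a i Move.N))
  /-- Aggregate payoffs at complete non-cooperation exceed those of any asymmetric profile. -/
  asymm_lt : ∀ a : Fin n → Move, a ≠ (fun _ => Move.C) → a ≠ (fun _ => Move.N) →
    ∑ i, π i a < ∑ i, π i (fun _ => Move.N)
  /-- The gain from `N` over `C` is smallest when all the others cooperate. -/
  gain_min : ∀ (i : Fin n) (a : Fin n → Move),
    π i (Function.update (fun _ => Move.C) i Move.N) - π i (fun _ => Move.C) ≤
      π i (Function.update a i Move.N) - π i (Function.update a i Move.C)

/-- The cooperation benefit (by symmetry it is the same for every player). -/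
def StageGame.benefit {n : ℕ} [NeZero n] (G : StageGame n) : ℝ :=
  G.π 0 (fun _ => Move.C) - G.π 0 (fun _ => Move.N)

/-- The deviation temptation (by symmetry it is the same for every player). -/
def StageGame.temptation {n : ℕ} [NeZero n] (G : StageGame n) : ℝ :=
  G.π 0 (Function.update (fun _ => Move.C) 0 Move.N) - G.π 0 (fun _ => Move.C)

/-! ### The stochastic game played by one team -/

/-- The stochastic game of one team. The exogenous state follows a Markov chain on the finite
set `S`; `game s` is the game that arrives in state `s`, if any; `β` is the effective discount
factor. -/
structure TeamGame (n : ℕ) (S : Type) [Fintype S] where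
  stage : Game → StageGame n
  start : stdSimplex ℝ S
  trans : S → stdSimplex ℝ S
  game : S → Option Game
  β : ℝ
  β_nonneg : 0 ≤ β
  β_lt_one : β < 1

/-- Past states and action profiles, most recent first. In a period without a game the recorded
profile is the placeholder in which every entry is `N`. -/
abbrev History (n : ℕ) (S : Type) := List (S × (Fin n → Move))

/-- A behavioral strategy: the probability of playing `C` after a history, given the current
state (which tells the current task and game). -/
abbrev Strategy (n : ℕ) (S : Type) := History n S → S → Set.Icc (0 : ℝ) 1

/-- One strategy for every player. -/
abbrev Profile (n : ℕ) (S : Type) := Fin n → Strategy n S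

namespace TeamGame

variable {n : ℕ} {S : Type} [Fintype S] (T : TeamGame n S)

/-- The probability that the action profile `a` is played in state `s` after `h`. Players
randomize independently; there is nothing to play when no game arrives. -/
def play (σ : Profile n S) (h : History n S) (s : S) (a : Fin n → Move) : ℝ :=
  match T.game s with
  | none => if a = (fun _ => Move.N) then 1 else 0
  | some _ => ∏ i, (if a i = Move.C then (σ i h s : ℝ) else 1 - (σ i h s : ℝ))

/-- The payoff of player `i` in one period; it is zero when no game arrives. -/
def periodPayoff (i : Fin n) (s : S) (a : Fin n → Move) : ℝ :=
  match T.game s with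
  | none => 0
  | some g => (T.stage g).π i a

/-- Expected payoff of player `i` in the period that lies `τ` periods ahead, given the history
`h` and the current state `s`, when `σ` is played. -/
def expectedPeriodPayoff (σ : Profile n S) (i : Fin n) : ℕ → History n S → S → ℝ
  | 0, h, s => ∑ a, T.play σ h s a * T.periodPayoff i s a
  | τ + 1, h, s => ∑ a, T.play σ h s a *
      ∑ s', T.trans s s' * expectedPeriodPayoff σ i τ ((s, a) :: h) s'

/-- Expected discounted payoff of player `i` in the subgame at history `h` and state `s`. The
series converges since period payoffs are bounded and `0 ≤ β < 1`. -/
noncomputable def payoff (σ : Profile n S) (i : Fin n) (h : History n S) (s : S) : ℝ :=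
  ∑' τ : ℕ, T.β ^ τ * T.expectedPeriodPayoff σ i τ h s

/-- Subgame-perfect equilibrium: a Nash equilibrium in the subgame at every history. -/
def IsSPE (σ : Profile n S) : Prop :=
  ∀ (h : History n S) (s : S) (i : Fin n) (σ' : Strategy n S),
    T.payoff (Function.update σ i σ') i h s ≤ T.payoff σ i h s

/-- The sum of the players' expected discounted payoffs. -/
noncomputable def totalPayoff (σ : Profile n S) : ℝ :=
  ∑ s, T.start s * ∑ i, T.payoff σ i [] s

/-- Player-optimal subgame-perfect equilibrium. -/
def IsPlayerOptimal (σ : Profile n S) : Prop :=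
  T.IsSPE σ ∧ ∀ σ' : Profile n S, T.IsSPE σ' → T.totalPayoff σ' ≤ T.totalPayoff σ

/-- The probability that `h` has occurred and that the current state is then `s`, under `σ`. -/
def reachProb (σ : Profile n S) : History n S → S → ℝ
  | [], s => T.start s
  | (s', a) :: h, s => reachProb σ h s' * T.play σ h s' a * T.trans s' s

/-- On the path of `σ`, all players cooperate whenever the state is `s`. -/
def HasCooperationIn (σ : Profile n S) (s : S) : Prop :=
  ∀ h : History n S, 0 < T.reachProb σ h s → ∀ i, (σ i h s : ℝ) = 1

/-- On the path of `σ`, no player cooperates whenever the state is `s`. -/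
def HasNoCooperationIn (σ : Profile n S) (s : S) : Prop :=
  ∀ h : History n S, 0 < T.reachProb σ h s → ∀ i, (σ i h s : ℝ) = 0

/-- There is cooperation in state `s` under player-optimal play. -/
def Cooperates (s : S) : Prop :=
  (∃ σ, T.IsPlayerOptimal σ) ∧ ∀ σ, T.IsPlayerOptimal σ → T.HasCooperationIn σ s

/-- There is no cooperation in any game under player-optimal play. -/
def PrecludesCooperation : Prop :=
  ∀ σ, T.IsPlayerOptimal σ → ∀ s, T.game s ≠ none → T.HasNoCooperationIn σ s

open Classical in
/-- Social value per period of a team whose states are distributed as `T.start`, when cooperation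
in game `g` is worth `V g`. -/
noncomputable def socialValue (V : Game → ℝ) : ℝ :=
  ∑ s, T.start s *
    (match T.game s with
      | none => 0
      | some g => if T.Cooperates s then V g else 0)

end TeamGame

/-! ### The organization -/

/-- The parameters of the organization. There are two tasks; the task labelled `g` is the one in
which game `g` arrives with probability `a g` per period and the other game never arrives. -/
structure Organization (n : ℕ) where
  stage : Game → StageGame n
  /-- The discount factor. -/
  δ : ℝ
  δ_pos : 0 < δ
  δ_lt_one : δ < 1
  /-- Arrival probabilities. -/
  a : Game → ℝ
  a_pos : ∀ g, 0 < a g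
  a_le_one : ∀ g, a g ≤ 1
  /-- Social values of cooperation in the two games. -/
  V : Game → ℝ
  V_good_pos : 0 < V Game.good
  V_bad_neg : V Game.bad < 0
  /-- The share of teams that must be assigned to each task. -/
  q : Game → ℝ
  q_nonneg : ∀ t, 0 ≤ q t
  q_sum : ∑ t, q t = 1

/-- A (static) assignment: a probability distribution over the two tasks. -/
abbrev Assignment : Type := ↥(stdSimplex ℝ Game)

/-- The assignment to the task labelled `g` for sure. -/
def Assignment.pure (g : Game) : Assignment :=
  ⟨Pi.single g 1, single_mem_stdSimplex ℝ g⟩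

/-- The task and the game, if any, of one period. -/
abbrev TaskGame := Game × Option Game

/-- States of a reactive assignment with memory `k + 1`: the tasks and games of the last `k + 1`
periods, the current period being the last entry. -/
abbrev RState (k : ℕ) := Fin (k + 1) → TaskGame

/-- A reactive assignment with memory `k + 1`. -/
abbrev ReactiveAssignment (k : ℕ) := RState k → stdSimplex ℝ Game

/-- The designer's assignment does not depend on more than past tasks and what is observed of
past games, where `obs` is the designer's observation of a game. -/
def ReactiveAssignment.Respects {k : ℕ} (obs : Option Game → Option Game)
    (m : ReactiveAssignment k) : Prop :=
  ∀ s s' : RState k, (∀ j, (s j).1 = (s' j).1 ∧ obs (s j).2 = obs (s' j).2) → m s = m s'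

/-- A static team structure: finitely many assignments with their population shares, and a
reshuffling rate for each (only the rates on the support matter). -/
structure StaticStructure where
  weight : Assignment →₀ ℝ
  weight_nonneg : ∀ ν, 0 ≤ weight ν
  weight_sum : ∑ ν ∈ weight.support, weight ν = 1
  rate : Assignment → Set.Icc (0 : ℝ) 1

namespace Organization

variable {n : ℕ} (O : Organization n)

/-- The cooperation benefit in game `g`. -/
def c [NeZero n] (g : Game) : ℝ := (O.stage g).benefit

/-- The deviation temptation in game `g`. -/
def d [NeZero n] (g : Game) : ℝ := (O.stage g).temptation

/-- The probability that `o` arrives in a period spent on task `t`. -/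
def arrival (t : Game) (o : Option Game) : ℝ :=
  match o with
  | none => 1 - O.a t
  | some g => if g = t then O.a t else 0

lemma arrival_nonneg (t : Game) (o : Option Game) : 0 ≤ O.arrival t o := by
  cases o with
  | none => simpa [arrival] using O.a_le_one t
  | some g =>
    simp only [arrival]
    split
    · exact (O.a_pos t).le
    · exact le_rfl

lemma arrival_sum (t : Game) : ∑ o, O.arrival t o = 1 := by
  simp [Fintype.sum_option, arrival]

/-- The joint distribution of task and game in a period when the task is drawn from `ν`. -/
def draw (ν : stdSimplex ℝ Game) : stdSimplex ℝ TaskGame :=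
  ⟨fun x => ν x.1 * O.arrival x.1 x.2,
    fun x => mul_nonneg (ν.2.1 x.1) (O.arrival_nonneg x.1 x.2), by
      rw [Fintype.sum_prod_type]
      simp only [← Finset.mul_sum, arrival_sum, mul_one]
      exact ν.2.2⟩

/-- The discount factor that results from the reshuffling rate `r`. -/
def effDiscount (r : Set.Icc (0 : ℝ) 1) : ℝ := (1 - (r : ℝ)) * O.δ

lemma effDiscount_nonneg (r : Set.Icc (0 : ℝ) 1) : 0 ≤ O.effDiscount r :=
  mul_nonneg (sub_nonneg.2 r.2.2) O.δ_pos.le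

lemma effDiscount_lt_one (r : Set.Icc (0 : ℝ) 1) : O.effDiscount r < 1 := by
  have h1 := r.2.1
  have h2 := O.δ_pos
  have h3 := O.δ_lt_one
  unfold effDiscount
  nlinarith

/-- The game of a team with assignment `ν` and reshuffling rate `r`: task and game are drawn
independently across periods. -/
def staticTeam (ν : Assignment) (r : Set.Icc (0 : ℝ) 1) : TeamGame n TaskGame where
  stage := O.stage
  start := O.draw ν
  trans := fun _ => O.draw ν
  game := fun s => s.2
  β := O.effDiscount r
  β_nonneg := O.effDiscount_nonneg r
  β_lt_one := O.effDiscount_lt_one r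

/-- The task-assignment constraint for static structures. -/
def StaticFeasible (lam : StaticStructure) : Prop :=
  ∀ t, ∑ ν ∈ lam.weight.support, lam.weight ν * ν t = O.q t

/-- The social value of a static structure. -/
noncomputable def staticValue (lam : StaticStructure) : ℝ :=
  ∑ ν ∈ lam.weight.support, lam.weight ν * (O.staticTeam ν (lam.rate ν)).socialValue O.V

/-- Optimality among all static structures. -/
def StaticOptimal (lam : StaticStructure) : Prop :=
  O.StaticFeasible lam ∧
    ∀ lam' : StaticStructure, O.StaticFeasible lam' → O.staticValue lam' ≤ O.staticValue lam

/-- The Markov chain on states that a reactive assignment induces: the oldest entry is dropped,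
the next task is drawn from `m s`, and then a game arrives or not. -/
def chain {k : ℕ} (m : ReactiveAssignment k) (s : RState k) : stdSimplex ℝ (RState k) :=
  ⟨fun s' => if Fin.init s' = Fin.tail s then O.draw (m s) (s' (Fin.last k)) else 0, by
    intro s'
    dsimp only
    split
    · exact (O.draw (m s)).2.1 _
    · exact le_rfl, by
    rw [← (Fin.snocEquiv (fun _ : Fin (k + 1) => TaskGame)).sum_comp, Fintype.sum_prod_type]
    simp only [Fin.snocEquiv, Equiv.coe_fn_mk, Fin.init_snoc, Fin.snoc_last]
    simp only [Finset.sum_ite_eq', Finset.mem_univ, if_true]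
    exact (O.draw (m s)).2.2⟩

/-- Steady-state distributions of a reactive assignment. -/
def IsSteady {k : ℕ} (m : ReactiveAssignment k) (μ : stdSimplex ℝ (RState k)) : Prop :=
  ∀ s, μ s = ∑ s', O.chain m s' s * μ s'

/-- The game of a team with reactive assignment `m`, reshuffling rate `r` and steady state `μ`. -/
def reactiveTeam {k : ℕ} (m : ReactiveAssignment k) (r : Set.Icc (0 : ℝ) 1)
    (μ : stdSimplex ℝ (RState k)) : TeamGame n (RState k) where
  stage := O.stage
  start := μ
  trans := O.chain m
  game := fun s => (s (Fin.last k)).2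
  β := O.effDiscount r
  β_nonneg := O.effDiscount_nonneg r
  β_lt_one := O.effDiscount_lt_one r

/-- A reactive team structure: finitely many reactive assignments with their population shares,
and for each a reshuffling rate and a steady state (only those on the support matter). -/
structure ReactiveStructure (k : ℕ) where
  weight : ReactiveAssignment k →₀ ℝ
  weight_nonneg : ∀ m, 0 ≤ weight m
  weight_sum : ∑ m ∈ weight.support, weight m = 1
  rate : ReactiveAssignment k → Set.Icc (0 : ℝ) 1
  steady : ReactiveAssignment k → stdSimplex ℝ (RState k)
  isSteady : ∀ m ∈ weight.support, O.IsSteady m (steady m)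

variable {k : ℕ}

/-- The structure uses only what the designer observes, and satisfies the task-assignment
constraint. -/
def ReactiveFeasible (obs : Option Game → Option Game) (Λ : O.ReactiveStructure k) : Prop :=
  (∀ m ∈ Λ.weight.support, ReactiveAssignment.Respects obs m) ∧
    ∀ t, ∑ m ∈ Λ.weight.support, Λ.weight m *
      ∑ s : RState k, (if (s (Fin.last k)).1 = t then Λ.steady m s else 0) = O.q t

/-- The social value of a reactive structure. -/
noncomputable def reactiveValue (Λ : O.ReactiveStructure k) : ℝ :=
  ∑ m ∈ Λ.weight.support,
    Λ.weight m * (O.reactiveTeam m (Λ.rate m) (Λ.steady m)).socialValue O.V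

/-- Optimality among all reactive structures with the same memory and observations. -/
def ReactiveOptimal (obs : Option Game → Option Game) (Λ : O.ReactiveStructure k) : Prop :=
  O.ReactiveFeasible obs Λ ∧
    ∀ Λ' : O.ReactiveStructure k, O.ReactiveFeasible obs Λ' →
      O.reactiveValue Λ' ≤ O.reactiveValue Λ

end Organization

/-! At `νcoop` the larger temptation equals the discounted benefit of future cooperation; as the
temptations differ, the smaller one is slack. Independent draws waste this slack, since they offer
the same prospect after either task. A designer who recalls only the current task can correlate the
next task with it: stickiness `ρ` leaves the long-run task shares unchanged, but shifts the prospect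
after task `t` by `δρ/(1-δρ)` times the deviation of the surplus of `t` from its mean
(`prospect_eq`). The hypotheses make the bad task the one with the larger surplus. So if the bad
temptation binds, a small `ρ > 0` relaxes it; if the good one binds, a small `ρ < 0` does. Both
constraints then hold strictly, and the share of the good task can be raised a little
(`exists_slack`).

The rest is accounting. If non-cooperating teams occupy the good task, the mass cooperating on the
bad task is held fixed and more teams cooperate on the good one; otherwise the mass cooperating on
the good task is held fixed and cooperation on the bad one shrinks. Either change raises the social
value strictly.

The game-theoretic input is `Enforceable.cooperates`. If future gains cover every temptation,
trigger strategies are subgame perfect; since full cooperation alone maximizes the sum of payoffs in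
each game, every player-optimal equilibrium must then cooperate on its path. Only this sufficient
condition is needed: the static benchmark is evaluated from the assumed form of the optimum
(`staticValue_of_support`), and its optimality takes care of all other static structures. -/

/-! ### Stage games: symmetric profiles and signs of benefit and temptation. -/

namespace StageGame

variable {n : ℕ} (G : StageGame n)

/-- Players swap roles without consequences, so symmetric profiles pay everyone the same. -/
lemma π_const (i j : Fin n) (x : Move) : G.π i (fun _ => x) = G.π j (fun _ => x) := by
  have h := G.symmetric (Equiv.swap j i) j (fun _ => x)
  rw [Equiv.swap_apply_left] at h
  exact h

lemma π_update_const (i j : Fin n) (x y : Move) :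
    G.π i (Function.update (fun _ => x) i y) = G.π j (Function.update (fun _ => x) j y) := by
  have h := G.symmetric (Equiv.swap j i) j (Function.update (fun _ => x) j y)
  rw [Equiv.swap_apply_left] at h
  rw [← h]
  congr 1
  ext l
  simp only [Function.comp, Function.update_apply, Equiv.symm_swap, Equiv.swap_apply_eq_iff,
    Equiv.swap_apply_left]

lemma π_all_C [NeZero n] (i : Fin n) :
    G.π i (fun _ => Move.C) = G.π i (fun _ => Move.N) + G.benefit := by
  rw [G.π_const i 0 Move.C, G.π_const i 0 Move.N, benefit]
  ring

lemma π_update_N [NeZero n] (i : Fin n) :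
    G.π i (Function.update (fun _ => Move.C) i Move.N) =
      G.π i (fun _ => Move.C) + G.temptation := by
  rw [G.π_update_const i 0, G.π_const i 0 Move.C, temptation]
  ring

lemma temptation_pos [NeZero n] : 0 < G.temptation := by
  have h := G.dominant 0 (fun _ => Move.C)
  rw [Function.update_eq_self_iff.2 rfl] at h
  exact sub_pos.2 h

lemma sum_π_all_C [NeZero n] :
    ∑ i, G.π i (fun _ => Move.C) = ∑ i, G.π i (fun _ => Move.N) + n * G.benefit := by
  simp [G.π_all_C, Finset.sum_add_distrib]

lemma benefit_pos [NeZero n] : 0 < G.benefit := by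
  have h := G.coop_max (fun _ => Move.N) (fun h => by simpa using congrFun h 0)
  rw [sum_π_all_C] at h
  have hn : (0 : ℝ) < n := Nat.cast_pos.2 (NeZero.pos n)
  nlinarith

end StageGame

/-! ### Payoffs of a fixed profile: bounds, Bellman equation, permanent non-cooperation. -/

namespace TeamGame

variable {n : ℕ} {S : Type} [Fintype S] (T : TeamGame n S)

lemma play_of_none {s : S} (hs : T.game s = none) (σ : Profile n S) (h : History n S)
    (a : Fin n → Move) : T.play σ h s a = if a = (fun _ => Move.N) then 1 else 0 := by
  simp only [play, hs]

lemma play_of_some {s : S} {g : Game} (hs : T.game s = some g) (σ : Profile n S)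
    (h : History n S) (a : Fin n → Move) :
    T.play σ h s a = ∏ i, (if a i = Move.C then (σ i h s : ℝ) else 1 - (σ i h s : ℝ)) := by
  simp only [play, hs]

lemma periodPayoff_of_none {s : S} (hs : T.game s = none) (i : Fin n) (a : Fin n → Move) :
    T.periodPayoff i s a = 0 := by
  simp only [periodPayoff, hs]

lemma periodPayoff_of_some {s : S} {g : Game} (hs : T.game s = some g) (i : Fin n)
    (a : Fin n → Move) : T.periodPayoff i s a = (T.stage g).π i a := by
  simp only [periodPayoff, hs]

lemma play_nonneg (σ : Profile n S) (h : History n S) (s : S) (a : Fin n → Move) :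
    0 ≤ T.play σ h s a := by
  cases hs : T.game s with
  | none => rw [T.play_of_none hs]; split <;> norm_num
  | some g =>
    rw [T.play_of_some hs]
    refine Finset.prod_nonneg fun i _ => ?_
    split
    · exact (σ i h s).2.1
    · exact sub_nonneg.2 (σ i h s).2.2

lemma sum_move (f : Move → ℝ) : ∑ m, f m = f Move.C + f Move.N := by
  have h : (Finset.univ : Finset Move) = {Move.C, Move.N} := rfl
  rw [h, Finset.sum_pair (by decide)]

lemma sum_play (σ : Profile n S) (h : History n S) (s : S) : ∑ a, T.play σ h s a = 1 := by
  cases hs : T.game s with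
  | none => simp [T.play_of_none hs]
  | some g =>
    simp only [T.play_of_some hs]
    have key := (Finset.prod_univ_sum (fun _ : Fin n => (Finset.univ : Finset Move))
      (fun i m => if m = Move.C then (σ i h s : ℝ) else 1 - (σ i h s : ℝ))).symm
    rw [Fintype.piFinset_univ] at key
    rw [key]
    simp [sum_move]

/-- In a period without a game the placeholder profile is recorded for sure. -/
lemma sum_play_of_none {s : S} (hs : T.game s = none) (σ : Profile n S) (h : History n S)
    (F : (Fin n → Move) → ℝ) : ∑ a, T.play σ h s a * F a = F (fun _ => Move.N) := by
  simp [T.play_of_none hs]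

/-- When all players but `i` play the pure action `m`, only the mixture of `i` matters. -/
lemma sum_play_of_pure {s : S} {g : Game} (hs : T.game s = some g) (σ : Profile n S)
    (h : History n S) (i : Fin n) (m : Move)
    (hσ : ∀ j ≠ i, (σ j h s : ℝ) = if m = Move.C then 1 else 0)
    (F : (Fin n → Move) → ℝ) :
    ∑ a, T.play σ h s a * F a =
      (σ i h s : ℝ) * F (Function.update (fun _ => m) i Move.C) +
        (1 - (σ i h s : ℝ)) * F (Function.update (fun _ => m) i Move.N) := by
  have hne : Function.update (fun _ => m) i Move.C ≠ Function.update (fun _ => m) i Move.N := by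
    intro h
    simpa using congrFun h i
  have hplay : ∀ x : Move, T.play σ h s (Function.update (fun _ => m) i x) =
      if x = Move.C then (σ i h s : ℝ) else 1 - (σ i h s : ℝ) := by
    intro x
    rw [T.play_of_some hs, Finset.prod_eq_single i]
    · simp
    · intro j _ hj
      rw [Function.update_of_ne hj, hσ j hj]
      cases m <;> simp
    · simp
  rw [← Finset.sum_subset (Finset.subset_univ
    ({Function.update (fun _ => m) i Move.C, Function.update (fun _ => m) i Move.N} :
      Finset (Fin n → Move))), Finset.sum_pair hne, hplay, hplay]
  · simp
  · intro a _ ha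
    have : ∃ j ≠ i, a j ≠ m := by
      by_contra! hcon
      apply ha
      have : a = Function.update (fun _ => m) i (a i) := by
        ext j
        by_cases hj : j = i
        · subst hj; simp
        · rw [Function.update_of_ne hj, hcon j hj]
      rw [this]
      cases a i <;> simp
    obtain ⟨j, hj, hjm⟩ := this
    rw [T.play_of_some hs, Finset.prod_eq_zero (Finset.mem_univ j), zero_mul]
    rw [hσ j hj]
    revert hjm
    cases m <;> cases a j <;> simp

lemma exists_periodPayoff_bound : ∃ M, ∀ i s a, |T.periodPayoff i s a| ≤ M := by
  have hb := Finite.bddAbove_range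
    (fun x : Fin n × S × (Fin n → Move) => |T.periodPayoff x.1 x.2.1 x.2.2|)
  obtain ⟨M, hM⟩ := hb
  exact ⟨M, fun i s a => hM ⟨(i, s, a), rfl⟩⟩

lemma abs_sum_mul_le {ι : Type*} [Fintype ι] {w f : ι → ℝ} {M : ℝ} (hw : ∀ x, 0 ≤ w x)
    (hsum : ∑ x, w x = 1) (hf : ∀ x, |f x| ≤ M) : |∑ x, w x * f x| ≤ M := by
  calc |∑ x, w x * f x| ≤ ∑ x, |w x * f x| := Finset.abs_sum_le_sum_abs _ _
    _ ≤ ∑ x, w x * M := by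
      refine Finset.sum_le_sum fun x _ => ?_
      rw [abs_mul, abs_of_nonneg (hw x)]
      exact mul_le_mul_of_nonneg_left (hf x) (hw x)
    _ = M := by rw [← Finset.sum_mul, hsum, one_mul]

lemma abs_expectedPeriodPayoff_le {M : ℝ} (hM : ∀ i s a, |T.periodPayoff i s a| ≤ M)
    (σ : Profile n S) (i : Fin n) (τ : ℕ) (h : History n S) (s : S) :
    |T.expectedPeriodPayoff σ i τ h s| ≤ M := by
  induction τ generalizing h s with
  | zero => exact abs_sum_mul_le (T.play_nonneg σ h s) (T.sum_play σ h s) (fun a => hM i s a)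
  | succ τ ih =>
    exact abs_sum_mul_le (T.play_nonneg σ h s) (T.sum_play σ h s) fun a =>
      abs_sum_mul_le (fun s' => (T.trans s).2.1 s') (T.trans s).2.2 fun s' => ih _ _

lemma summable_payoff (σ : Profile n S) (i : Fin n) (h : History n S) (s : S) :
    Summable fun τ : ℕ => T.β ^ τ * T.expectedPeriodPayoff σ i τ h s := by
  obtain ⟨M, hM⟩ := T.exists_periodPayoff_bound
  refine Summable.of_norm_bounded (g := fun τ => T.β ^ τ * M)
    ((summable_geometric_of_lt_one T.β_nonneg T.β_lt_one).mul_right M) fun τ => ?_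
  rw [Real.norm_eq_abs, abs_mul, abs_of_nonneg (pow_nonneg T.β_nonneg τ)]
  exact mul_le_mul_of_nonneg_left (T.abs_expectedPeriodPayoff_le hM σ i τ h s)
    (pow_nonneg T.β_nonneg τ)

lemma exists_payoff_bound : ∃ M, ∀ σ i h s, |T.payoff σ i h s| ≤ M := by
  obtain ⟨M, hM⟩ := T.exists_periodPayoff_bound
  refine ⟨(1 - T.β)⁻¹ * M, fun σ i h s => ?_⟩
  have hg : HasSum (fun τ : ℕ => T.β ^ τ * M) ((1 - T.β)⁻¹ * M) :=
    (hasSum_geometric_of_lt_one T.β_nonneg T.β_lt_one).mul_right M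
  rw [← Real.norm_eq_abs]
  refine tsum_of_norm_bounded hg fun τ => ?_
  rw [Real.norm_eq_abs, abs_mul, abs_of_nonneg (pow_nonneg T.β_nonneg τ)]
  exact mul_le_mul_of_nonneg_left (T.abs_expectedPeriodPayoff_le hM σ i τ h s)
    (pow_nonneg T.β_nonneg τ)

/-- The Bellman equation for the payoff of a fixed profile. -/
lemma payoff_eq (σ : Profile n S) (i : Fin n) (h : History n S) (s : S) :
    T.payoff σ i h s = ∑ a, T.play σ h s a * (T.periodPayoff i s a +
      T.β * ∑ s', T.trans s s' * T.payoff σ i ((s, a) :: h) s') := by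
  have h1 : T.payoff σ i h s = T.expectedPeriodPayoff σ i 0 h s +
      ∑' τ : ℕ, T.β ^ (τ + 1) * T.expectedPeriodPayoff σ i (τ + 1) h s := by
    rw [payoff, (T.summable_payoff σ i h s).tsum_eq_zero_add]
    simp
  have h2 : HasSum (fun τ : ℕ => T.β ^ (τ + 1) * T.expectedPeriodPayoff σ i (τ + 1) h s)
      (∑ a, T.play σ h s a *
        (T.β * ∑ s', T.trans s s' * T.payoff σ i ((s, a) :: h) s')) := by
    have h3 : HasSum (fun τ : ℕ => ∑ a, T.play σ h s a * (T.β * ∑ s', T.trans s s' *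
        (T.β ^ τ * T.expectedPeriodPayoff σ i τ ((s, a) :: h) s')))
        (∑ a, T.play σ h s a *
          (T.β * ∑ s', T.trans s s' * T.payoff σ i ((s, a) :: h) s')) :=
      hasSum_sum fun a _ => HasSum.mul_left _ <| HasSum.mul_left _ <|
        hasSum_sum fun s' _ => HasSum.mul_left _ (T.summable_payoff σ i _ s').hasSum
    convert h3 using 2 with τ
    simp only [expectedPeriodPayoff, Finset.mul_sum]
    refine Finset.sum_congr rfl fun a _ => Finset.sum_congr rfl fun s' _ => ?_
    ring
  rw [h1, h2.tsum_eq, expectedPeriodPayoff, ← Finset.sum_add_distrib]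
  simp only [mul_add]

/-- A bounded function that discounting and the flow of play can only increase is nonpositive. -/
lemma nonpos_of_le_discounted (σ : Profile n S) (A : S → Prop)
    (hA : ∀ s s', A s → T.trans s s' ≠ 0 → A s') (F : History n S → S → ℝ) {M : ℝ}
    (hM : ∀ h s, F h s ≤ M)
    (hF : ∀ h s, A s → F h s ≤
      ∑ a, T.play σ h s a * (T.β * ∑ s', T.trans s s' * F ((s, a) :: h) s'))
    (h : History n S) {s : S} (hs : A s) : F h s ≤ 0 := by
  -- Each use of `hF` gains a factor `T.β`. `A` is inherited only along transitions of positive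
  -- probability, which is all the expectation sees.
  have key : ∀ (τ : ℕ) (h : History n S) (s : S), A s → F h s ≤ T.β ^ τ * M := by
    intro τ
    induction τ with
    | zero => intro h s _; simpa using hM h s
    | succ τ ih =>
      intro h s hs
      refine (hF h s hs).trans ?_
      calc ∑ a, T.play σ h s a * (T.β * ∑ s', T.trans s s' * F ((s, a) :: h) s')
          ≤ ∑ a, T.play σ h s a * (T.β * ∑ s', T.trans s s' * (T.β ^ τ * M)) := by
            refine Finset.sum_le_sum fun a _ => mul_le_mul_of_nonneg_left ?_
              (T.play_nonneg σ h s a)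
            refine mul_le_mul_of_nonneg_left (Finset.sum_le_sum fun s' _ => ?_) T.β_nonneg
            by_cases h0 : T.trans s s' = 0
            · simp [h0]
            · exact mul_le_mul_of_nonneg_left (ih _ _ (hA s s' hs h0)) ((T.trans s).2.1 s')
        _ = T.β ^ (τ + 1) * M := by
          rw [← Finset.sum_mul, T.sum_play, one_mul, ← Finset.sum_mul, stdSimplex.sum_eq_one]
          ring
  have hlim : Filter.Tendsto (fun τ : ℕ => T.β ^ τ * M) Filter.atTop (nhds 0) := by
    simpa using (tendsto_pow_atTop_nhds_zero_of_lt_one T.β_nonneg T.β_lt_one).mul_const M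
  exact ge_of_tendsto' hlim fun τ => key τ h s hs

/-- The profile in which nobody ever cooperates. -/
def neverCooperate : Profile n S := fun _ _ _ => ⟨0, by simp⟩

/-- The payoff of a player when nobody ever cooperates. -/
noncomputable def nashValue (i : Fin n) (s : S) : ℝ := T.payoff neverCooperate i [] s

/-- The profile ignores the history, so the past can be dropped. -/
lemma expectedPeriodPayoff_neverCooperate (i : Fin n) (τ : ℕ) (h : History n S) (s : S) :
    T.expectedPeriodPayoff neverCooperate i τ h s =
      T.expectedPeriodPayoff neverCooperate i τ [] s := by
  induction τ generalizing h s with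
  | zero => rfl
  | succ τ ih =>
    simp only [expectedPeriodPayoff]
    refine Finset.sum_congr rfl fun a _ => ?_
    simp only [ih ((s, a) :: h), ih [(s, a)]]
    rfl

lemma payoff_neverCooperate (i : Fin n) (h : History n S) (s : S) :
    T.payoff neverCooperate i h s = T.nashValue i s := by
  simp only [nashValue, payoff, T.expectedPeriodPayoff_neverCooperate i _ h]

lemma nashValue_eq [NeZero n] (i : Fin n) (s : S) :
    T.nashValue i s = T.periodPayoff i s (fun _ => Move.N) +
      T.β * ∑ s', T.trans s s' * T.nashValue i s' := by
  have h1 := T.payoff_eq neverCooperate i [] s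
  rw [T.payoff_neverCooperate] at h1
  simp only [T.payoff_neverCooperate] at h1
  rw [h1]
  cases hs : T.game s with
  | none => rw [T.sum_play_of_none hs]
  | some g =>
    rw [T.sum_play_of_pure hs neverCooperate [] i Move.N (fun j _ => by simp [neverCooperate])]
    simp [neverCooperate]

end TeamGame

/-! ### Trigger strategies form a subgame-perfect equilibrium. -/

namespace TeamGame

variable {n : ℕ} {S : Type}

/-- Every past profile is the one that `plan` prescribes for the state of its period. -/
abbrev Clean (plan : S → Move) (h : History n S) : Prop := ∀ e ∈ h, e.2 = fun _ => plan e.1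

/-- Follow `plan` as long as everyone has done so, and never cooperate again otherwise. -/
def grim (plan : S → Move) : Profile n S := fun _ h s =>
  if Clean plan h ∧ plan s = Move.C then ⟨1, by simp⟩ else ⟨0, by simp⟩

lemma grim_of_pos {plan : S → Move} {h : History n S} {s : S} (hc : Clean plan h ∧ plan s = Move.C) (i : Fin n) :
    (grim plan i h s : ℝ) = 1 := by
  rw [grim, if_pos hc]

lemma grim_of_neg {plan : S → Move} {h : History n S} {s : S} (hc : ¬(Clean plan h ∧ plan s = Move.C))
    (i : Fin n) : (grim plan i h s : ℝ) = 0 := by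
  rw [grim, if_neg hc]

variable [Fintype S] (T : TeamGame n S)

/-- What everyone gains in state `s` over complete non-cooperation when `plan` is followed. -/
noncomputable def planBenefit [NeZero n] (plan : S → Move) (s : S) : ℝ :=
  match T.game s with
  | none => 0
  | some g => if plan s = Move.C then (T.stage g).benefit else 0

/-- The plan `plan` is enforceable by reverting to non-cooperation; `gain s` is what everyone
gains from following it, from state `s` on, over never cooperating. -/
structure Enforceable [NeZero n] (plan : S → Move) (gain : S → ℝ) : Prop where
  plan_of_none : ∀ s, T.game s = none → plan s = Move.N
  gain_eq : ∀ s, gain s = T.planBenefit plan s + T.β * ∑ s', T.trans s s' * gain s'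
  gain_nonneg : ∀ s, 0 ≤ gain s
  incentive : ∀ s g, T.game s = some g → plan s = Move.C →
    (T.stage g).temptation ≤ T.β * ∑ s', T.trans s s' * gain s'

/-- The payoff that `grim` yields to player `i`. -/
noncomputable def grimValue (plan : S → Move) (gain : S → ℝ) (i : Fin n) (h : History n S)
    (s : S) : ℝ :=
  T.nashValue i s + if Clean plan h then gain s else 0

variable {T} {plan : S → Move} {gain : S → ℝ}

lemma exists_grimValue_bound (T : TeamGame n S) (plan : S → Move) (gain : S → ℝ) :
    ∃ M, ∀ i h s, |T.grimValue plan gain i h s| ≤ M := by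
  obtain ⟨M, hM⟩ := Finite.bddAbove_range
    (fun x : Fin n × S => |T.nashValue x.1 x.2| + |gain x.2|)
  refine ⟨M, fun i h s => le_trans ?_ (hM ⟨(i, s), rfl⟩)⟩
  rw [grimValue]
  split
  · exact abs_add_le _ _
  · simp

lemma sum_play_sub (σ : Profile n S) (i : Fin n) (Φ : History n S → S → ℝ) (h : History n S)
    (s : S) :
    ∑ a, T.play σ h s a * (T.β * ∑ s', T.trans s s' *
        (T.payoff σ i ((s, a) :: h) s' - Φ ((s, a) :: h) s')) =
      T.payoff σ i h s - ∑ a, T.play σ h s a *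
        (T.periodPayoff i s a + T.β * ∑ s', T.trans s s' * Φ ((s, a) :: h) s') := by
  rw [T.payoff_eq σ i h s, ← Finset.sum_sub_distrib]
  refine Finset.sum_congr rfl fun a _ => ?_
  simp only [mul_sub, Finset.sum_sub_distrib]
  ring

section Grim

variable [NeZero n]

/-- No player can improve on `grim` in a single period, given the continuation payoffs. -/
lemma Enforceable.grim_step (H : T.Enforceable plan gain) (σ : Profile n S) (i : Fin n) (h : History n S) (s : S)
    (hσ : ∀ j ≠ i, σ j h s = grim plan j h s) :
    ∑ a, T.play σ h s a * (T.periodPayoff i s a +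
        T.β * ∑ s', T.trans s s' * T.grimValue plan gain i ((s, a) :: h) s') ≤
      T.grimValue plan gain i h s ∧
    (σ i h s = grim plan i h s →
      ∑ a, T.play σ h s a * (T.periodPayoff i s a +
        T.β * ∑ s', T.trans s s' * T.grimValue plan gain i ((s, a) :: h) s') =
      T.grimValue plan gain i h s) := by
  set Q : (Fin n → Move) → ℝ := fun a => T.periodPayoff i s a +
    T.β * ∑ s', T.trans s s' * T.grimValue plan gain i ((s, a) :: h) s' with hQdef
  set K := T.β * ∑ s', T.trans s s' * T.nashValue i s' with hK
  set L := T.β * ∑ s', T.trans s s' * gain s' with hL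
  have hL0 : 0 ≤ L := mul_nonneg T.β_nonneg
    (Finset.sum_nonneg fun s' _ => mul_nonneg ((T.trans s).2.1 s') (H.gain_nonneg s'))
  have hnash := T.nashValue_eq i s
  rw [← hK] at hnash
  have hgain := H.gain_eq s
  rw [← hL] at hgain
  -- The continuation after `a` is worth `K + L` if the history stays clean, and only `K` otherwise;
  -- `L` is what a deviation forfeits.
  have hQ1 : ∀ a, a = (fun _ => plan s) → Clean plan h → Q a = T.periodPayoff i s a + K + L := by
    intro a ha hh
    have hc : Clean plan ((s, a) :: h) := List.forall_mem_cons.2 ⟨ha, hh⟩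
    simp only [hQdef, grimValue, if_pos hc, hK, hL, mul_add, Finset.sum_add_distrib]
    ring
  have hQ0 : ∀ a, ¬(a = (fun _ => plan s) ∧ Clean plan h) → Q a = T.periodPayoff i s a + K := by
    intro a ha
    have hc : ¬Clean plan ((s, a) :: h) := fun hc => ha (List.forall_mem_cons.1 hc)
    simp only [hQdef, grimValue, if_neg hc, hK, add_zero]
  have hx0 : (0 : ℝ) ≤ σ i h s := (σ i h s).2.1
  have hx1 : (σ i h s : ℝ) ≤ 1 := (σ i h s).2.2
  cases hs : T.game s with
  | none =>
    have hp := H.plan_of_none s hs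
    have hpb : T.planBenefit plan s = 0 := by simp only [planBenefit, hs]
    have hpp := T.periodPayoff_of_none hs i
    rw [T.sum_play_of_none hs]
    have : Q (fun _ => Move.N) = T.grimValue plan gain i h s := by
      by_cases hh : Clean plan h
      · rw [hQ1 _ (by rw [hp]) hh, grimValue, if_pos hh, hnash, hgain, hpb]; ring
      · rw [hQ0 _ (fun hc => hh hc.2), grimValue, if_neg hh, hnash]; ring
    exact ⟨this.le, fun _ => this⟩
  | some g =>
    have hpp := T.periodPayoff_of_some hs i
    by_cases hc : Clean plan h ∧ plan s = Move.C
    · have hpb : T.planBenefit plan s = (T.stage g).benefit := by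
        simp only [planBenefit, hs, hc.2, if_true]
      rw [T.sum_play_of_pure hs σ h i Move.C
        (fun j hj => by rw [hσ j hj, grim_of_pos hc]; simp)]
      have hC : Function.update (fun _ : Fin n => Move.C) i Move.C = fun _ => Move.C :=
        Function.update_eq_self_iff.2 rfl
      have e1 : Q (fun _ => Move.C) = T.grimValue plan gain i h s := by
        rw [hQ1 _ (by rw [hc.2]) hc.1, grimValue, if_pos hc.1, hnash, hgain, hpb, hpp, hpp,
          (T.stage g).π_all_C]
        ring
      -- Defecting earns the temptation now and forfeits `L`, which `incentive` makes at least as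
      -- large.
      have e2 : Q (Function.update (fun _ => Move.C) i Move.N) ≤
          T.grimValue plan gain i h s := by
        have hne : Function.update (fun _ : Fin n => Move.C) i Move.N ≠ fun _ => plan s := by
          rw [hc.2]
          intro h'
          simpa using congrFun h' i
        rw [← e1, hQ0 _ (fun h' => hne h'.1), hQ1 _ (by rw [hc.2]) hc.1, hpp, hpp,
          (T.stage g).π_update_N]
        linarith [H.incentive s g hs hc.2]
      change (σ i h s : ℝ) * Q _ + (1 - (σ i h s : ℝ)) * Q _ ≤ _ ∧
        (_ → (σ i h s : ℝ) * Q _ + (1 - (σ i h s : ℝ)) * Q _ = _)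
      rw [hC, e1]
      refine ⟨by nlinarith, fun hi => ?_⟩
      rw [hi, grim_of_pos hc]
      ring
    · rw [T.sum_play_of_pure hs σ h i Move.N
        (fun j hj => by rw [hσ j hj, grim_of_neg hc]; simp)]
      have hN : Function.update (fun _ : Fin n => Move.N) i Move.N = fun _ => Move.N :=
        Function.update_eq_self_iff.2 rfl
      have e1 : Q (fun _ => Move.N) = T.grimValue plan gain i h s := by
        by_cases hh : Clean plan h
        · have hpN : plan s = Move.N := by
            cases hps : plan s with
            | C => exact absurd ⟨hh, hps⟩ hc
            | N => rfl
          have hpb : T.planBenefit plan s = 0 := by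
            simp [planBenefit, hs, hpN]
          rw [hQ1 _ (by rw [hpN]) hh, grimValue, if_pos hh, hnash, hgain, hpb]
          ring
        · rw [hQ0 _ (fun h' => hh h'.2), grimValue, if_neg hh, hnash]
          ring
      -- A lone cooperator never keeps the history clean here, so nothing is gained later, and
      -- dominance makes it costly now.
      have e2 : Q (Function.update (fun _ => Move.N) i Move.C) ≤
          T.grimValue plan gain i h s := by
        have hno : ¬(Function.update (fun _ : Fin n => Move.N) i Move.C = (fun _ => plan s) ∧
            Clean plan h) := by
          rintro ⟨h1, h2⟩
          exact hc ⟨h2, by simpa using (congrFun h1 i).symm⟩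
        have hQN : T.periodPayoff i s (fun _ => Move.N) + K ≤ Q (fun _ => Move.N) := by
          by_cases hh : (fun _ : Fin n => Move.N) = (fun _ => plan s) ∧ Clean plan h
          · rw [hQ1 _ hh.1 hh.2]; linarith
          · rw [hQ0 _ hh]
        rw [← e1, hQ0 _ hno]
        refine le_trans ?_ hQN
        rw [hpp, hpp]
        have := (T.stage g).dominant i (fun _ => Move.N)
        rw [hN] at this
        linarith
      change (σ i h s : ℝ) * Q _ + (1 - (σ i h s : ℝ)) * Q _ ≤ _ ∧
        (_ → (σ i h s : ℝ) * Q _ + (1 - (σ i h s : ℝ)) * Q _ = _)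
      rw [hN, e1]
      refine ⟨by nlinarith, fun hi => ?_⟩
      rw [hi, grim_of_neg hc]
      ring

/-- One-shot deviation principle: the excess of the deviator's payoff over `grimValue` is bounded
and, by `grim_step`, at most its own discounted expectation, hence never positive. -/
lemma Enforceable.payoff_update_le (H : T.Enforceable plan gain) (i : Fin n) (σ' : Strategy n S) (h : History n S) (s : S) :
    T.payoff (Function.update (grim plan) i σ') i h s ≤ T.grimValue plan gain i h s := by
  obtain ⟨M, hM⟩ := T.exists_payoff_bound
  obtain ⟨M', hM'⟩ := exists_grimValue_bound T plan gain
  refine sub_nonpos.1 (T.nonpos_of_le_discounted (Function.update (grim plan) i σ')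
    (fun _ => True) (fun _ _ _ _ => trivial)
    (fun h s => T.payoff (Function.update (grim plan) i σ') i h s - T.grimValue plan gain i h s)
    (M := M + M') (fun h s => ?_) (fun h s _ => ?_) h trivial)
  · linarith [abs_le.1 (hM (Function.update (grim plan) i σ') i h s), abs_le.1 (hM' i h s)]
  · rw [sum_play_sub]
    have := (H.grim_step (Function.update (grim plan) i σ') i h s
      (fun j hj => by rw [Function.update_of_ne hj])).1
    linarith

/-- One bound comes from the trivial deviation to `grim` itself, the other from the same discounting
argument with the sign reversed, using the equality case of `grim_step`. -/
lemma Enforceable.payoff_grim (H : T.Enforceable plan gain) (i : Fin n) (h : History n S) (s : S) :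
    T.payoff (grim plan) i h s = T.grimValue plan gain i h s := by
  refine le_antisymm ?_ ?_
  · simpa using H.payoff_update_le i (grim plan i) h s
  obtain ⟨M, hM⟩ := T.exists_payoff_bound
  obtain ⟨M', hM'⟩ := exists_grimValue_bound T plan gain
  refine sub_nonpos.1 (T.nonpos_of_le_discounted (grim plan)
    (fun _ => True) (fun _ _ _ _ => trivial)
    (fun h s => T.grimValue plan gain i h s - T.payoff (grim plan) i h s)
    (M := M + M') (fun h s => ?_) (fun h s _ => ?_) h trivial)
  · linarith [abs_le.1 (hM (grim plan) i h s), abs_le.1 (hM' i h s)]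
  · have h1 := (H.grim_step (grim plan) i h s (fun _ _ => rfl)).2 rfl
    have h2 := sum_play_sub (T := T) (grim plan) i (T.grimValue plan gain i) h s
    have h3 : ∑ a, T.play (grim plan) h s a * (T.β * ∑ s', T.trans s s' *
        (T.grimValue plan gain i ((s, a) :: h) s' - T.payoff (grim plan) i ((s, a) :: h) s')) =
        -∑ a, T.play (grim plan) h s a * (T.β * ∑ s', T.trans s s' *
        (T.payoff (grim plan) i ((s, a) :: h) s' - T.grimValue plan gain i ((s, a) :: h) s')) := by
      simp only [mul_sub, Finset.sum_sub_distrib]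
      ring
    rw [h3, h2, h1]
    linarith

lemma Enforceable.isSPE_grim (H : T.Enforceable plan gain) : T.IsSPE (grim plan) := fun h s i σ' => by
  rw [H.payoff_grim]
  exact H.payoff_update_le i σ' h s

end Grim

/-! ### Every player-optimal equilibrium attains full cooperation. -/

variable (T) in
/-- In the states that occur, `plan` calls for cooperation in every game. -/
structure PlansCooperation (plan : S → Move) : Prop where
  start : ∀ s, T.start s ≠ 0 → T.game s ≠ none → plan s = Move.C
  trans : ∀ s s', T.trans s s' ≠ 0 → T.game s' ≠ none → plan s' = Move.C

variable (T gain) in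
/-- The sum of payoffs under full cooperation minus that under `σ`. -/
noncomputable def shortfall (σ : Profile n S) (h : History n S) (s : S) : ℝ :=
  ∑ i, (T.nashValue i s + gain s) - ∑ i, T.payoff σ i h s

/-- The first term does not depend on `σ`, so maximizing total payoff means minimizing the expected
initial shortfall. -/
lemma totalPayoff_eq_sub_shortfall (σ : Profile n S) :
    T.totalPayoff σ = ∑ s, T.start s * ∑ i, (T.nashValue i s + gain s) -
      ∑ s, T.start s * T.shortfall gain σ [] s := by
  rw [totalPayoff, ← Finset.sum_sub_distrib]
  refine Finset.sum_congr rfl fun s _ => ?_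
  rw [shortfall]
  ring

section Bound

variable [NeZero n]

variable (T plan) in
/-- The sum of period payoffs under full cooperation minus that under `a`. -/
noncomputable def periodShortfall (s : S) (a : Fin n → Move) : ℝ :=
  ∑ i, (T.periodPayoff i s (fun _ => Move.N) + T.planBenefit plan s) - ∑ i, T.periodPayoff i s a

/-- The recursion for the benchmark `nashValue + gain` does not involve actions, so it may be
averaged over the play of `σ` and combined with the Bellman equation of `σ`. -/
lemma Enforceable.shortfall_eq (H : T.Enforceable plan gain) (σ : Profile n S) (h : History n S) (s : S) :
    T.shortfall gain σ h s = ∑ a, T.play σ h s a * (T.periodShortfall plan s a +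
      T.β * ∑ s', T.trans s s' * T.shortfall gain σ ((s, a) :: h) s') := by
  have key : ∀ i, T.nashValue i s + gain s - T.payoff σ i h s =
      ∑ a, T.play σ h s a * (T.periodPayoff i s (fun _ => Move.N) + T.planBenefit plan s -
        T.periodPayoff i s a + T.β * ∑ s', T.trans s s' *
          (T.nashValue i s' + gain s' - T.payoff σ i ((s, a) :: h) s')) := by
    intro i
    have h1 : T.nashValue i s + gain s = ∑ a, T.play σ h s a *
        (T.periodPayoff i s (fun _ => Move.N) + T.planBenefit plan s +
          T.β * ∑ s', T.trans s s' * (T.nashValue i s' + gain s')) := by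
      rw [← Finset.sum_mul, T.sum_play, one_mul, T.nashValue_eq, H.gain_eq]
      simp only [mul_add, Finset.sum_add_distrib]
      ring
    rw [h1, T.payoff_eq σ i h s, ← Finset.sum_sub_distrib]
    refine Finset.sum_congr rfl fun a _ => ?_
    simp only [mul_sub, Finset.sum_sub_distrib]
    ring
  have hp : ∀ a, T.periodShortfall plan s a = ∑ i, (T.periodPayoff i s (fun _ => Move.N) +
      T.planBenefit plan s - T.periodPayoff i s a) := fun a => by
    rw [periodShortfall, Finset.sum_sub_distrib]
  have hq : ∀ h s, T.shortfall gain σ h s = ∑ i, (T.nashValue i s + gain s - T.payoff σ i h s) :=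
    fun h s => by rw [shortfall, Finset.sum_sub_distrib]
  rw [hq, Finset.sum_congr rfl fun i _ => key i, Finset.sum_comm]
  refine Finset.sum_congr rfl fun a _ => ?_
  rw [← Finset.mul_sum, Finset.sum_add_distrib, ← hp, ← Finset.mul_sum, Finset.sum_comm]
  simp only [hq, Finset.mul_sum]

lemma periodShortfall_nonneg {s : S} (hs : T.game s ≠ none → plan s = Move.C)
    (a : Fin n → Move) : 0 ≤ T.periodShortfall plan s a ∧
      (T.game s ≠ none → T.periodShortfall plan s a = 0 → a = fun _ => Move.C) := by
  cases hg : T.game s with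
  | none => simp [periodShortfall, T.periodPayoff_of_none hg, planBenefit, hg]
  | some g =>
    have hp := hs (by simp [hg])
    have e : T.periodShortfall plan s a =
        ∑ i, (T.stage g).π i (fun _ => Move.C) - ∑ i, (T.stage g).π i a := by
      simp only [periodShortfall, T.periodPayoff_of_some hg, planBenefit, hg, hp, if_true,
        ← (T.stage g).π_all_C]
    rw [e]
    by_cases ha : a = fun _ => Move.C
    · subst ha; simp
    · have := (T.stage g).coop_max a ha
      exact ⟨by linarith, fun _ h => by linarith⟩

/-- Valid for every profile, equilibrium or not: no period shortfall is negative where the plan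
cooperates, and by `P` such states lead only to such states. -/
lemma Enforceable.shortfall_nonneg (H : T.Enforceable plan gain) (P : T.PlansCooperation plan) (σ : Profile n S)
    (h : History n S) {s : S} (hs : T.game s ≠ none → plan s = Move.C) :
    0 ≤ T.shortfall gain σ h s := by
  obtain ⟨M, hM⟩ := T.exists_payoff_bound
  obtain ⟨M', hM'⟩ := Finite.bddAbove_range (fun s => |∑ i, (T.nashValue i s + gain s)|)
  refine neg_nonpos.1 (T.nonpos_of_le_discounted σ
    (fun s => T.game s ≠ none → plan s = Move.C) (fun s s' _ h' => P.trans s s' h')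
    (fun h s => -T.shortfall gain σ h s) (M := n * M + M') (fun h s => ?_)
    (fun h s hs => ?_) h hs)
  · have h1 : ∑ i, T.payoff σ i h s ≤ n * M := by
      refine (Finset.sum_le_card_nsmul _ _ M fun i _ => (abs_le.1 (hM σ i h s)).2).trans ?_
      simp
    have h2 : |∑ i, (T.nashValue i s + gain s)| ≤ M' := hM' ⟨s, rfl⟩
    rw [shortfall]
    linarith [abs_le.1 h2]
  · rw [H.shortfall_eq σ h s, ← Finset.sum_neg_distrib]
    refine Finset.sum_le_sum fun a _ => ?_
    rw [← mul_neg]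
    refine mul_le_mul_of_nonneg_left ?_ (T.play_nonneg σ h s a)
    simp only [mul_neg, Finset.sum_neg_distrib]
    linarith [(periodShortfall_nonneg hs a).1]

/-- With a zero shortfall everyone cooperates now, and there is no shortfall later. -/
lemma Enforceable.of_shortfall_eq_zero (H : T.Enforceable plan gain) (P : T.PlansCooperation plan) (hβ : 0 < T.β)
    {σ : Profile n S} {h : History n S} {s : S} (hs : T.game s ≠ none → plan s = Move.C)
    (h0 : T.shortfall gain σ h s = 0) {a : Fin n → Move} (ha : T.play σ h s a ≠ 0) :
    (T.game s ≠ none → a = fun _ => Move.C) ∧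
      ∀ s', T.trans s s' ≠ 0 → T.shortfall gain σ ((s, a) :: h) s' = 0 := by
  -- The sign of the shortfall is known only where the plan cooperates; all other states have
  -- transition probability zero.
  have hterm : ∀ s', 0 ≤ T.trans s s' * T.shortfall gain σ ((s, a) :: h) s' := by
    intro s'
    by_cases h' : T.trans s s' = 0
    · simp [h']
    · exact mul_nonneg ((T.trans s).2.1 s') (H.shortfall_nonneg P σ _ (P.trans s s' h'))
  have hsum : ∀ b, 0 ≤ T.play σ h s b * (T.periodShortfall plan s b +
      T.β * ∑ s', T.trans s s' * T.shortfall gain σ ((s, b) :: h) s') := by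
    intro b
    refine mul_nonneg (T.play_nonneg σ h s b) (add_nonneg (periodShortfall_nonneg hs b).1
      (mul_nonneg hβ.le (Finset.sum_nonneg fun s' _ => ?_)))
    by_cases h' : T.trans s s' = 0
    · simp [h']
    · exact mul_nonneg ((T.trans s).2.1 s') (H.shortfall_nonneg P σ _ (P.trans s s' h'))
  rw [H.shortfall_eq, Finset.sum_eq_zero_iff_of_nonneg fun b _ => hsum b] at h0
  have h1 := (mul_eq_zero.1 (h0 a (Finset.mem_univ a))).resolve_left ha
  have h2 := (periodShortfall_nonneg hs a).1
  have h3 : 0 ≤ ∑ s', T.trans s s' * T.shortfall gain σ ((s, a) :: h) s' :=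
    Finset.sum_nonneg fun s' _ => hterm s'
  have h4 := mul_nonneg hβ.le h3
  refine ⟨fun hg => (periodShortfall_nonneg hs a).2 hg (by linarith), fun s' hs' => ?_⟩
  have h5 : ∑ s', T.trans s s' * T.shortfall gain σ ((s, a) :: h) s' = 0 :=
    (mul_eq_zero.1 (by linarith : T.β * _ = 0)).resolve_left hβ.ne'
  rw [Finset.sum_eq_zero_iff_of_nonneg fun s' _ => hterm s'] at h5
  exact (mul_eq_zero.1 (h5 s' (Finset.mem_univ s'))).resolve_left hs'

lemma Enforceable.start_mul_shortfall_nonneg (H : T.Enforceable plan gain) (P : T.PlansCooperation plan) (σ : Profile n S)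
    (s : S) : 0 ≤ T.start s * T.shortfall gain σ [] s := by
  by_cases h' : T.start s = 0
  · simp [h']
  · exact mul_nonneg (T.start.2.1 s) (H.shortfall_nonneg P σ _ (P.start s h'))

lemma Enforceable.shortfall_grim (H : T.Enforceable plan gain) (s : S) : T.shortfall gain (grim plan) [] s = 0 := by
  simp [shortfall, H.payoff_grim, grimValue]

lemma Enforceable.isPlayerOptimal_grim (H : T.Enforceable plan gain) (P : T.PlansCooperation plan) :
    T.IsPlayerOptimal (grim plan) := by
  refine ⟨H.isSPE_grim, fun σ' _ => ?_⟩
  rw [totalPayoff_eq_sub_shortfall (gain := gain), totalPayoff_eq_sub_shortfall (gain := gain) (grim plan)]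
  simp only [H.shortfall_grim, mul_zero, Finset.sum_const_zero]
  linarith [Finset.sum_nonneg fun s (_ : s ∈ Finset.univ) => H.start_mul_shortfall_nonneg P σ' s]

/-- An optimal profile does at least as well as `grim`, whose shortfall is zero, so its expected
initial shortfall vanishes; this is then passed on step by step along the path. -/
lemma Enforceable.shortfall_eq_zero_of_reachProb (H : T.Enforceable plan gain) (P : T.PlansCooperation plan) (hβ : 0 < T.β)
    {σ : Profile n S} (hσ : T.IsPlayerOptimal σ) (h : History n S) (s : S)
    (hr : T.reachProb σ h s ≠ 0) :
    (T.game s ≠ none → plan s = Move.C) ∧ T.shortfall gain σ h s = 0 := by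
  induction h generalizing s with
  | nil =>
    refine ⟨P.start s hr, ?_⟩
    have h1 := hσ.2 _ H.isSPE_grim
    rw [totalPayoff_eq_sub_shortfall (gain := gain), totalPayoff_eq_sub_shortfall (gain := gain) σ] at h1
    simp only [H.shortfall_grim, mul_zero, Finset.sum_const_zero] at h1
    have h2 : ∑ s, T.start s * T.shortfall gain σ [] s = 0 := le_antisymm (by linarith)
      (Finset.sum_nonneg fun s _ => H.start_mul_shortfall_nonneg P σ s)
    rw [Finset.sum_eq_zero_iff_of_nonneg fun s _ => H.start_mul_shortfall_nonneg P σ s] at h2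
    exact (mul_eq_zero.1 (h2 s (Finset.mem_univ s))).resolve_left hr
  | cons e h ih =>
    obtain ⟨s', a⟩ := e
    simp only [reachProb, mul_ne_zero_iff] at hr
    obtain ⟨h1, h2⟩ := ih s' hr.1.1
    exact ⟨P.trans s' s hr.2, (H.of_shortfall_eq_zero P hβ h1 h2 hr.1.2).2 s hr.2⟩

/-- If cooperation in every game that occurs is enforceable, it is the player-optimal outcome. -/
theorem Enforceable.cooperates (H : T.Enforceable plan gain) (P : T.PlansCooperation plan) (hβ : 0 < T.β) {s : S}
    (hs : T.game s ≠ none) : T.Cooperates s := by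
  refine ⟨⟨_, H.isPlayerOptimal_grim P⟩, fun σ hσ h hr i => ?_⟩
  obtain ⟨h1, h2⟩ := H.shortfall_eq_zero_of_reachProb P hβ hσ h s hr.ne'
  obtain ⟨g, hg⟩ := Option.ne_none_iff_exists'.1 hs
  have h3 : T.play σ h s (fun _ => Move.C) = 1 := by
    rw [← T.sum_play σ h s, Finset.sum_eq_single (fun _ => Move.C)]
    · intro a _ ha
      by_contra hne
      exact ha ((H.of_shortfall_eq_zero P hβ h1 h2 hne).1 hs)
    · simp
  rw [T.play_of_some hg] at h3
  simp only [if_true] at h3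
  -- The product of the cooperation probabilities is one, and it is at most each of its factors.
  refine le_antisymm (σ i h s).2.2 ?_
  refine h3.ge.trans ?_
  rw [← Finset.mul_prod_erase _ _ (Finset.mem_univ i)]
  refine mul_le_of_le_one_right (σ i h s).2.1 (Finset.prod_le_one ?_ ?_)
  · exact fun j _ => (σ j h s).2.1
  · exact fun j _ => (σ j h s).2.2

end Bound

/-! ### Social value with and without cooperation. -/

/-- Players without a future do not cooperate. -/
lemma not_cooperates_of_β_eq_zero [NeZero n] (hβ : T.β = 0) {s : S} (hs : T.game s ≠ none)
    (h0 : 0 < T.start s) : ¬T.Cooperates s := by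
  rintro ⟨⟨σ, hσ⟩, hall⟩
  have hone := hall σ hσ [] h0
  obtain ⟨g, hg⟩ := Option.ne_none_iff_exists'.1 hs
  have hdev := hσ.1 [] s 0 (neverCooperate 0)
  rw [T.payoff_eq, T.payoff_eq σ] at hdev
  simp only [hβ, zero_mul, add_zero] at hdev
  rw [T.sum_play_of_pure hg _ [] 0 Move.C
      (fun j hj => by rw [Function.update_of_ne hj, hone j]; simp),
    T.sum_play_of_pure hg σ [] 0 Move.C (fun j _ => by rw [hone j]; simp), hone 0,
    T.periodPayoff_of_some hg, T.periodPayoff_of_some hg] at hdev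
  have := (T.stage g).dominant 0 (fun _ => Move.C)
  rw [Function.update_eq_self_iff.2 rfl] at this
  simp [neverCooperate] at hdev
  linarith

lemma socialValue_eq_zero (V : Game → ℝ)
    (h : ∀ s, T.game s ≠ none → 0 < T.start s → ¬T.Cooperates s) : T.socialValue V = 0 := by
  refine Finset.sum_eq_zero fun s _ => ?_
  rcases (T.start.2.1 s).eq_or_lt with h0 | h0
  · exact mul_eq_zero_of_left h0.symm _
  · refine mul_eq_zero_of_right _ ?_
    have := h s
    cases hg : T.game s with
    | none => rfl
    | some g => simpa only using if_neg (this (by simp [hg]) h0)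

/-- `Cooperates` includes the existence of an optimal equilibrium, in which player `0` would have to
cooperate initially with probability both one and zero. -/
lemma socialValue_of_precludesCooperation [NeZero n] (V : Game → ℝ)
    (h : T.PrecludesCooperation) : T.socialValue V = 0 := by
  refine T.socialValue_eq_zero V fun s hs h0 => ?_
  rintro ⟨⟨σ, hσ⟩, hall⟩
  have h1 := hall σ hσ [] h0 0
  have h2 := h σ hσ s hs [] h0 0
  linarith

/-- The social value of a team that cooperates in every game. -/
lemma socialValue_of_cooperates (V : Game → ℝ)
    (h : ∀ s, T.game s ≠ none → T.Cooperates s) :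
    T.socialValue V = ∑ s, T.start s * (T.game s).elim 0 V := by
  refine Finset.sum_congr rfl fun s _ => ?_
  have := h s
  cases hg : T.game s with
  | none => rfl
  | some g =>
    simp only [Option.elim_some]
    rw [if_pos (this (by simp [hg]))]

end TeamGame

lemma Game.sum_eq {M : Type*} [AddCommMonoid M] (f : Game → M) :
    ∑ g, f g = f Game.good + f Game.bad := by
  have h : (Finset.univ : Finset Game) = {Game.good, Game.bad} := rfl
  rw [h, Finset.sum_pair (by decide)]

/-! ### Windows of consecutive values of a stationary Markov chain. -/

section PathMeasure

variable {X : Type*} [Fintype X] (π : stdSimplex ℝ X) (P : X → stdSimplex ℝ X)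

/-- The distribution of `k + 1` consecutive values of a Markov chain that starts from `π`. -/
noncomputable def pathMeasure : (k : ℕ) → (Fin (k + 1) → X) → ℝ
  | 0, s => π (s 0)
  | k + 1, s => pathMeasure k (Fin.init s) *
      P (Fin.init (α := fun _ => X) s (Fin.last k)) (s (Fin.last (k + 1)))

lemma pathMeasure_nonneg (k : ℕ) (s : Fin (k + 1) → X) : 0 ≤ pathMeasure π P k s := by
  induction k with
  | zero => exact π.2.1 _
  | succ k ih => exact mul_nonneg (ih _) ((P _).2.1 _)

lemma sum_snoc {k : ℕ} {M : Type*} [AddCommMonoid M] (f : (Fin (k + 1) → X) → M) :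
    ∑ s, f s = ∑ x, ∑ s : Fin k → X, f (Fin.snoc (α := fun _ => X) s x) := by
  rw [← (Fin.snocEquiv (fun _ : Fin (k + 1) => X)).sum_comp, Fintype.sum_prod_type]
  rfl

lemma sum_cons {k : ℕ} {M : Type*} [AddCommMonoid M] (f : (Fin (k + 1) → X) → M) :
    ∑ s, f s = ∑ x, ∑ s : Fin k → X, f (Fin.cons (α := fun _ => X) x s) := by
  rw [← (Fin.consEquiv (fun _ : Fin (k + 1) => X)).sum_comp, Fintype.sum_prod_type]
  rfl

variable {π P}

/-- Stationarity of `π` makes the last value of the chain distributed as the first. -/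
lemma sum_pathMeasure_mul_last (hπ : ∀ y, ∑ x, π x * P x y = π y) (k : ℕ) (f : X → ℝ) :
    ∑ s, pathMeasure π P k s * f (s (Fin.last k)) = ∑ x, π x * f x := by
  induction k generalizing f with
  | zero =>
    rw [← (Equiv.funUnique (Fin 1) X).symm.sum_comp]
    rfl
  | succ k ih =>
    rw [sum_snoc]
    simp only [pathMeasure, Fin.init_snoc, Fin.snoc_last]
    rw [Finset.sum_comm]
    simp only [mul_assoc, ← Finset.mul_sum]
    -- The last step is absorbed into the test function.
    rw [ih (fun x => ∑ y, P x y * f y)]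
    simp only [Finset.mul_sum, ← mul_assoc]
    rw [Finset.sum_comm]
    simp only [← Finset.sum_mul, hπ]

/-- Summing out the oldest value leaves the law of a shorter path, by stationarity at the start; the
induction removes the newest value, which commutes with prepending. -/
lemma sum_pathMeasure_cons (hπ : ∀ y, ∑ x, π x * P x y = π y) (k : ℕ) (s : Fin (k + 1) → X) :
    ∑ x, pathMeasure π P (k + 1) (Fin.cons (α := fun _ => X) x s) = pathMeasure π P k s := by
  induction k with
  | zero => exact hπ (s 0)
  | succ k ih =>
    have hinit : ∀ x, Fin.init (α := fun _ => X) (Fin.cons (α := fun _ => X) x s) =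
        Fin.cons (α := fun _ => X) x (Fin.init s) := by
      intro x
      ext j
      refine Fin.cases rfl (fun j => rfl) j
    conv_lhs => enter [2, x]; rw [pathMeasure, hinit]
    have hlast : ∀ x, Fin.cons (α := fun _ => X) x (Fin.init (α := fun _ => X) s)
        (Fin.last (k + 1)) = Fin.init (α := fun _ => X) s (Fin.last k) := fun x => rfl
    have hlast' : ∀ x, Fin.cons (α := fun _ => X) x s (Fin.last (k + 2)) =
        s (Fin.last (k + 1)) := fun x => rfl
    simp only [hlast, hlast', ← Finset.sum_mul]
    rw [ih]
    rfl

/-- The predecessors of a window `s` are `Fin.cons x (Fin.init s)`. Weight times transition is the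
weight of the longer path `Fin.cons x s`, and `x` is summed out. The kernel is written as in
`Organization.chain`. -/
lemma pathMeasure_steady (hπ : ∀ y, ∑ x, π x * P x y = π y) (k : ℕ)
    [DecidableEq (Fin k → X)] (s : Fin (k + 1) → X) :
    ∑ s' : Fin (k + 1) → X, (if Fin.init (α := fun _ => X) s = Fin.tail s' then P (s' (Fin.last k)) (s (Fin.last k)) else 0) *
      pathMeasure π P k s' = pathMeasure π P k s := by
  rw [← sum_pathMeasure_cons hπ k s, sum_cons]
  refine Finset.sum_congr rfl fun x _ => ?_
  rw [Finset.sum_eq_single (Fin.init s)]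
  · have hinit : Fin.init (α := fun _ => X) (Fin.cons (α := fun _ => X) x s) =
        Fin.cons (α := fun _ => X) x (Fin.init s) := by
      ext j
      refine Fin.cases rfl (fun j => rfl) j
    rw [Fin.tail_cons, if_pos rfl, pathMeasure, hinit, mul_comm]
    rfl
  · intro t _ ht
    rw [Fin.tail_cons, if_neg (Ne.symm ht), zero_mul]
  · simp

/-- The path measure of a stationary chain, as a probability distribution. -/
noncomputable def stationaryPath (hπ : ∀ y, ∑ x, π x * P x y = π y) (k : ℕ) :
    stdSimplex ℝ (Fin (k + 1) → X) :=
  ⟨pathMeasure π P k, pathMeasure_nonneg π P k, by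
    simpa using sum_pathMeasure_mul_last hπ k (fun _ => 1)⟩

end PathMeasure

/-! ### Sticky task chains and the prospects they create. -/

/-- The next task is drawn from `ν` with weight `1 - ρ` and is the current task with weight `ρ`,
which may be negative. -/
noncomputable def sticky (ν : Assignment) (ρ : ℝ) (hρ1 : ρ ≤ 1)
    (hρ : ∀ t, 0 ≤ (1 - ρ) * ν t + ρ) (t : Game) : stdSimplex ℝ Game :=
  ⟨fun t' => (1 - ρ) * ν t' + if t' = t then ρ else 0, by
    intro t'
    dsimp only
    split
    · exact hρ t'
    · rw [add_zero]
      exact mul_nonneg (sub_nonneg.2 hρ1) (ν.2.1 t'), by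
    rw [Finset.sum_add_distrib, ← Finset.mul_sum, stdSimplex.sum_eq_one]
    simp⟩

section Sticky

variable {ν : Assignment} {ρ : ℝ} {hρ1 : ρ ≤ 1} {hρ : ∀ t, 0 ≤ (1 - ρ) * ν t + ρ}

lemma sticky_apply (t t' : Game) :
    sticky ν ρ hρ1 hρ t t' = (1 - ρ) * ν t' + if t' = t then ρ else 0 := rfl

lemma sum_sticky_mul (t : Game) (f : Game → ℝ) :
    ∑ t', sticky ν ρ hρ1 hρ t t' * f t' = (1 - ρ) * ∑ t', ν t' * f t' + ρ * f t := by
  simp only [sticky_apply, add_mul, Finset.sum_add_distrib, Finset.mul_sum, mul_assoc]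
  simp

end Sticky

namespace Organization

variable {n : ℕ} (O : Organization n)

lemma draw_apply (ν : stdSimplex ℝ Game) (x : TaskGame) :
    O.draw ν x = ν x.1 * O.arrival x.1 x.2 := rfl

lemma sum_draw_mul (ν : stdSimplex ℝ Game) (f : TaskGame → ℝ) :
    ∑ x, O.draw ν x * f x =
      ∑ t, ν t * (O.a t * f (t, some t) + (1 - O.a t) * f (t, none)) := by
  rw [Fintype.sum_prod_type]
  refine Finset.sum_congr rfl fun t _ => ?_
  simp only [draw_apply, mul_assoc, ← Finset.mul_sum, Fintype.sum_option, arrival]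
  simp
  ring_nf
  simp

lemma game_eq_of_draw_ne_zero {ν : stdSimplex ℝ Game} {x : TaskGame} (h : O.draw ν x ≠ 0)
    (hx : x.2 ≠ none) : x.2 = some x.1 := by
  obtain ⟨t, o⟩ := x
  cases o with
  | none => exact absurd rfl hx
  | some g =>
    by_contra hne
    refine h ?_
    have : g ≠ t := fun h => hne (by rw [h])
    simp [draw_apply, arrival, this]

/-- The expected benefit of cooperation per period on task `t`. -/
noncomputable def surplus [NeZero n] (t : Game) : ℝ := O.a t * O.c t

/-- The discounted benefit of future cooperation for a team that is now on task `t` and whose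
later tasks follow the chain `sticky ν ρ`. -/
noncomputable def prospect [NeZero n] (ν : Assignment) (ρ : ℝ) (t : Game) : ℝ :=
  O.δ / (1 - O.δ) * ∑ t', ν t' * O.surplus t' +
    O.δ * ρ / (1 - O.δ * ρ) * (O.surplus t - ∑ t', ν t' * O.surplus t')

/-- The sticky kernel fixes constants and multiplies deviations from the `ν`-mean by `ρ`. Discounted
future surpluses are thus two geometric series, with ratios `δ` and `δρ`, both beginning with the
next period. -/
lemma prospect_eq [NeZero n] {ν : Assignment} {ρ : ℝ} (hρ1 : ρ ≤ 1)
    (hρ : ∀ t, 0 ≤ (1 - ρ) * ν t + ρ) (t : Game) :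
    O.prospect ν ρ t =
      O.δ * ∑ t', sticky ν ρ hρ1 hρ t t' * (O.surplus t' + O.prospect ν ρ t') := by
  have h0 := O.δ_pos
  have h1 : 1 - O.δ ≠ 0 := by linarith [O.δ_lt_one]
  have h2 : 1 - O.δ * ρ ≠ 0 := by nlinarith [O.δ_lt_one]
  rw [sum_sticky_mul]
  have h3 : ∑ t', ν t' * (O.surplus t' + O.prospect ν ρ t') =
      (1 + O.δ / (1 - O.δ)) * ∑ t', ν t' * O.surplus t' := by
    have h4 : ∀ c e m : ℝ, ∑ t', ν t' * (O.surplus t' + (c + e * (O.surplus t' - m))) =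
        (1 + e) * ∑ t', ν t' * O.surplus t' + (c - e * m) * ∑ t', ν t' := by
      intro c e m
      rw [Finset.mul_sum, Finset.mul_sum, ← Finset.sum_add_distrib]
      exact Finset.sum_congr rfl fun _ _ => by ring
    simp only [prospect, h4, stdSimplex.sum_eq_one]
    ring
  rw [h3, prospect]
  generalize ∑ t', ν t' * O.surplus t' = m
  field_simp
  ring

/-- A team whose tasks follow a sticky chain cooperates in every game if each temptation is at
most the discounted benefit of future cooperation. -/
lemma cooperates_of_sticky [NeZero n] {S : Type} [Fintype S] {T : TeamGame n S}
    {ν : Assignment} {ρ : ℝ} {hρ1 : ρ ≤ 1} {hρ : ∀ t, 0 ≤ (1 - ρ) * ν t + ρ}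
    (now : S → TaskGame) (hstage : T.stage = O.stage) (hgame : ∀ s, T.game s = (now s).2)
    (hβ : T.β = O.δ)
    (hstart : ∀ s, T.start s ≠ 0 → (now s).2 ≠ none → (now s).2 = some (now s).1)
    (htrans : ∀ s s', T.trans s s' ≠ 0 → (now s').2 ≠ none → (now s').2 = some (now s').1)
    (hker : ∀ s (f : TaskGame → ℝ), ∑ s', T.trans s s' * f (now s') =
      ∑ x, O.draw (sticky ν ρ hρ1 hρ (now s).1) x * f x)
    (hd : ∀ t, O.d t ≤ O.prospect ν ρ t) {s : S} (hs : T.game s ≠ none) : T.Cooperates s := by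
  -- A game foreign to the task never arrives. Planning `N` there avoids an incentive constraint
  -- that `hd` would not supply.
  set plan : S → Move := fun s => if (now s).2 = some (now s).1 then Move.C else Move.N with hplan
  have hben : ∀ s, T.planBenefit plan s =
      if (now s).2 = some (now s).1 then O.c (now s).1 else 0 := by
    intro s
    cases hg : (now s).2 with
    | none => simp [TeamGame.planBenefit, hgame, hg]
    | some g =>
      by_cases h : g = (now s).1
      · simp [TeamGame.planBenefit, hgame, hg, hplan, h, hstage, c]
      · simp [TeamGame.planBenefit, hgame, hg, hplan, h]
  have hgain : ∀ s, T.β * ∑ s', T.trans s s' *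
      (T.planBenefit plan s' + O.prospect ν ρ (now s').1) = O.prospect ν ρ (now s).1 := by
    intro s
    simp only [hben]
    rw [hker s (fun x => (if x.2 = some x.1 then O.c x.1 else 0) + O.prospect ν ρ x.1),
      sum_draw_mul, hβ, O.prospect_eq hρ1 hρ (now s).1]
    congr 1
    refine Finset.sum_congr rfl fun t _ => ?_
    simp [surplus]
    ring_nf
    simp
  have hpos : ∀ t, 0 ≤ O.prospect ν ρ t := fun t =>
    ((O.stage t).temptation_pos.le).trans (hd t)
  have H : T.Enforceable plan (fun s => T.planBenefit plan s + O.prospect ν ρ (now s).1) := by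
    refine ⟨fun s h => ?_, fun s => ?_, fun s => ?_, fun s g hg hp => ?_⟩
    · rw [hgame] at h
      simp [hplan, h]
    · rw [hgain]
    · refine add_nonneg ?_ (hpos _)
      rw [hben]
      split
      · exact ((O.stage (now s).1).benefit_pos).le
      · exact le_rfl
    · rw [hgain]
      have h1 : (now s).2 = some (now s).1 := by
        by_contra hne
        simp [hplan, hne] at hp
      rw [hgame, h1, Option.some_inj] at hg
      rw [← hg, hstage]
      exact hd _
  refine H.cooperates ⟨fun s h1 h2 => ?_, fun s s' h1 h2 => ?_⟩ (hβ ▸ O.δ_pos) hs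
  · simp only [hplan]
    exact if_pos (hstart s h1 (hgame s ▸ h2))
  · simp only [hplan]
    exact if_pos (htrans s s' h1 (hgame s' ▸ h2))

end Organization

/-! ### Values of static and of sticky reactive teams. -/

namespace Organization

variable {n : ℕ} (O : Organization n)

lemma sum_chain_mul {k : ℕ} (m : ReactiveAssignment k) (s : RState k) (f : TaskGame → ℝ) :
    ∑ s', O.chain m s s' * f (s' (Fin.last k)) = ∑ x, O.draw (m s) x * f x := by
  have h : ∀ s', O.chain m s s' =
      if Fin.init s' = Fin.tail s then O.draw (m s) (s' (Fin.last k)) else 0 := fun _ => rfl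
  rw [sum_snoc]
  simp only [h, Fin.init_snoc, Fin.snoc_last]
  simp

lemma draw_of_chain_ne_zero {k : ℕ} {m : ReactiveAssignment k} {s s' : RState k}
    (h : O.chain m s s' ≠ 0) : O.draw (m s) (s' (Fin.last k)) ≠ 0 := by
  have h' : O.chain m s s' =
      if Fin.init s' = Fin.tail s then O.draw (m s) (s' (Fin.last k)) else 0 := rfl
  rw [h'] at h
  exact fun h0 => h (by rw [h0, ite_self])

/-- A team with an i.i.d. assignment cooperates in every game if each temptation is at most the
discounted benefit of future cooperation. -/
lemma staticTeam_cooperates [NeZero n] {ν : Assignment} {r : Set.Icc (0 : ℝ) 1}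
    (hr : (r : ℝ) = 0)
    (hd : ∀ t, O.d t ≤ O.δ / (1 - O.δ) * ∑ t', ν t' * O.surplus t') {s : TaskGame}
    (hs : (O.staticTeam ν r).game s ≠ none) : (O.staticTeam ν r).Cooperates s := by
  -- Independent draws are the sticky chain with `ρ = 0`, for which the second term of `prospect`
  -- vanishes.
  have hρ : ∀ t, 0 ≤ (1 - 0) * ν t + 0 := fun t => by simp
  refine O.cooperates_of_sticky (T := O.staticTeam ν r) (ν := ν) (ρ := 0) (hρ1 := zero_le_one)
    (hρ := hρ) id rfl (fun _ => rfl) ?_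
    (fun s h => O.game_eq_of_draw_ne_zero h) (fun s s' h => O.game_eq_of_draw_ne_zero h)
    (fun s f => ?_) (fun t => by simpa [prospect] using hd t) hs
  · simp [staticTeam, effDiscount, hr]
  · have : sticky ν 0 zero_le_one hρ (id s).1 = ν := by
      ext t
      simp [sticky_apply]
    rw [this]
    rfl

lemma staticTeam_socialValue [NeZero n] {ν : Assignment} {r : Set.Icc (0 : ℝ) 1}
    (hr : (r : ℝ) = 0)
    (hd : ∀ t, O.d t ≤ O.δ / (1 - O.δ) * ∑ t', ν t' * O.surplus t') :
    (O.staticTeam ν r).socialValue O.V = ∑ t, ν t * (O.a t * O.V t) := by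
  rw [TeamGame.socialValue_of_cooperates _ fun s hs => O.staticTeam_cooperates hr hd hs]
  have := O.sum_draw_mul ν (fun x => x.2.elim 0 O.V)
  exact this.trans (by simp)

section Reactive

variable {ν : Assignment} {ρ : ℝ} {hρ1 : ρ ≤ 1} {hρ : ∀ t, 0 ≤ (1 - ρ) * ν t + ρ} {k : ℕ}

/-- The reactive assignment that draws the next task from `sticky ν ρ`. -/
noncomputable def stickyAssignment (k : ℕ) (ν : Assignment) (ρ : ℝ) (hρ1 : ρ ≤ 1)
    (hρ : ∀ t, 0 ≤ (1 - ρ) * ν t + ρ) : ReactiveAssignment k :=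
  fun s => sticky ν ρ hρ1 hρ (s (Fin.last k)).1

lemma respects_stickyAssignment (obs : Option Game → Option Game) :
    (stickyAssignment k ν ρ hρ1 hρ).Respects obs := by
  intro s s' h
  simp only [stickyAssignment, (h (Fin.last k)).1]

/-- `(1 - ρ) ν + ρ ν = ν` for either sign of `ρ`, and arrivals depend only on the current task. -/
lemma draw_stationary (y : TaskGame) :
    ∑ x : TaskGame, O.draw ν x * O.draw (sticky ν ρ hρ1 hρ x.1) y = O.draw ν y := by
  rw [O.sum_draw_mul ν fun x => O.draw (sticky ν ρ hρ1 hρ x.1) y]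
  simp only [draw_apply, sticky_apply]
  have h := stdSimplex.sum_eq_one ν
  simp only [Game.sum_eq] at h ⊢
  have hg : ν Game.good = 1 - ν Game.bad := by linarith
  rcases y with ⟨_ | _, o⟩ <;> simp [hg] <;> ring

/-- The steady state of a sticky reactive assignment. -/
noncomputable def stickySteady (k : ℕ) (ν : Assignment) (ρ : ℝ) (hρ1 : ρ ≤ 1)
    (hρ : ∀ t, 0 ≤ (1 - ρ) * ν t + ρ) : stdSimplex ℝ (RState k) :=
  stationaryPath (fun y => O.draw_stationary (hρ1 := hρ1) (hρ := hρ) y) k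

lemma isSteady_stickySteady :
    O.IsSteady (stickyAssignment k ν ρ hρ1 hρ) (O.stickySteady k ν ρ hρ1 hρ) := fun s =>
  (pathMeasure_steady (fun y => O.draw_stationary (hρ1 := hρ1) (hρ := hρ) y) k s).symm

lemma sum_stickySteady_mul (f : TaskGame → ℝ) :
    ∑ s, O.stickySteady k ν ρ hρ1 hρ s * f (s (Fin.last k)) = ∑ x, O.draw ν x * f x :=
  sum_pathMeasure_mul_last (fun y => O.draw_stationary (hρ1 := hρ1) (hρ := hρ) y) k f

lemma sum_stickySteady_task (t : Game) :
    ∑ s : RState k, (if (s (Fin.last k)).1 = t then O.stickySteady k ν ρ hρ1 hρ s else 0) =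
      ν t := by
  have h1 := O.sum_stickySteady_mul (hρ1 := hρ1) (hρ := hρ) (k := k)
    (fun x => if x.1 = t then 1 else 0)
  rw [sum_draw_mul] at h1
  refine Eq.trans (by simp) (h1.trans ?_)
  rw [Game.sum_eq]
  cases t <;> simp

/-- A window weighs no more than the marginal probability of its last entry, which `draw ν` gives.
-/
lemma game_eq_of_stickySteady_ne_zero {s : RState k} (h : O.stickySteady k ν ρ hρ1 hρ s ≠ 0) :
    (s (Fin.last k)).2 ≠ none → (s (Fin.last k)).2 = some (s (Fin.last k)).1 := by
  classical
  intro hs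
  by_contra hne
  have h1 := O.sum_stickySteady_mul (hρ1 := hρ1) (hρ := hρ) (k := k)
    (fun x => if x = s (Fin.last k) then 1 else 0)
  simp only [mul_ite, mul_one, mul_zero, Finset.sum_ite_eq', Finset.mem_univ, if_true] at h1
  have h2 : O.draw ν (s (Fin.last k)) = 0 := by
    by_contra h0
    exact hne (O.game_eq_of_draw_ne_zero h0 hs)
  rw [h2, Finset.sum_eq_zero_iff_of_nonneg] at h1
  · exact h (by simpa using h1 s (Finset.mem_univ s))
  · intro s' _
    split
    · exact (O.stickySteady k ν ρ hρ1 hρ).2.1 s'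
    · exact le_rfl

lemma reactiveTeam_socialValue [NeZero n] (hd : ∀ t, O.d t ≤ O.prospect ν ρ t) :
    (O.reactiveTeam (stickyAssignment k ν ρ hρ1 hρ) 0
      (O.stickySteady k ν ρ hρ1 hρ)).socialValue O.V = ∑ t, ν t * (O.a t * O.V t) := by
  rw [TeamGame.socialValue_of_cooperates]
  · have h := O.sum_stickySteady_mul (hρ1 := hρ1) (hρ := hρ) (k := k)
      (fun x => x.2.elim 0 O.V)
    rw [sum_draw_mul] at h
    exact h.trans (by simp)
  · intro s hs
    refine O.cooperates_of_sticky (hρ1 := hρ1) (hρ := hρ) (fun s => s (Fin.last k)) rfl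
      (fun _ => rfl) ?_ (fun s h => O.game_eq_of_stickySteady_ne_zero h)
      (fun s s' h => O.game_eq_of_draw_ne_zero (O.draw_of_chain_ne_zero h))
      (fun s f => O.sum_chain_mul _ s f) hd hs
    simp [reactiveTeam, effDiscount]

end Reactive

lemma reactiveTeam_socialValue_of_rate_one [NeZero n] {k : ℕ} (m : ReactiveAssignment k)
    (μ : stdSimplex ℝ (RState k)) : (O.reactiveTeam m 1 μ).socialValue O.V = 0 :=
  TeamGame.socialValue_eq_zero _ fun _ hs h0 =>
    TeamGame.not_cooperates_of_β_eq_zero (by simp [reactiveTeam, effDiscount]) hs h0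

/-- A share `w` of teams cooperates on a sticky assignment, all others sit on task `g` and do not
cooperate. -/
lemma exists_reactiveStructure [NeZero n] {ν : Assignment} {ρ : ℝ} (hρ1 : ρ < 1)
    (hν : ∀ t, 0 < ν t) (hρ : ∀ t, 0 < (1 - ρ) * ν t + ρ) (hd : ∀ t, O.d t ≤ O.prospect ν ρ t)
    {w : ℝ} (hw0 : 0 ≤ w) (hw1 : w ≤ 1) (g : Game)
    (hq : ∀ t, w * ν t + (1 - w) * (if t = g then 1 else 0) = O.q t)
    (k : ℕ) (obs : Option Game → Option Game) :
    ∃ Λ : O.ReactiveStructure k, O.ReactiveFeasible obs Λ ∧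
      O.reactiveValue Λ = w * ∑ t, ν t * (O.a t * O.V t) := by
  classical
  have hp : ∀ t, 0 ≤ (1 - 0) * Assignment.pure g t + 0 := fun t => by simp
  set m₁ : ReactiveAssignment k := stickyAssignment k ν ρ hρ1.le (fun t => (hρ t).le) with hm₁
  set m₂ : ReactiveAssignment k := stickyAssignment k (Assignment.pure g) 0 zero_le_one hp
    with hm₂
  have hpure : ∀ t, Assignment.pure g t = if t = g then 1 else 0 := fun t => by
    change (Pi.single g (1 : ℝ) : Game → ℝ) t = _
    rw [Pi.single_apply]
  -- Rates and steady states are indexed by assignments, so the two must differ: from task `g`, only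
  -- `m₁` moves to the other task with positive probability.
  have hne : m₂ ≠ m₁ := by
    intro h
    obtain ⟨t, ht⟩ : ∃ t : Game, t ≠ g := by cases g; exacts [⟨.bad, by simp⟩, ⟨.good, by simp⟩]
    have h1 := congrArg (fun μ : stdSimplex ℝ Game => μ t)
      (congrFun h (fun _ => (g, none)))
    simp only [hm₁, hm₂, stickyAssignment, sticky_apply, hpure, if_neg ht] at h1
    have := mul_pos (sub_pos.2 hρ1) (hν t)
    linarith
  set W : ReactiveAssignment k →₀ ℝ := Finsupp.single m₁ w + Finsupp.single m₂ (1 - w) with hW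
  -- Passing through `Finsupp.sum` avoids asking whether one of the shares vanishes.
  have hsum : ∀ F : ReactiveAssignment k → ℝ,
      ∑ m ∈ W.support, W m * F m = w * F m₁ + (1 - w) * F m₂ := by
    intro F
    change W.sum (fun m x => x * F m) = _
    rw [hW, Finsupp.sum_add_index' (by simp) (by intros; ring),
      Finsupp.sum_single_index (by simp), Finsupp.sum_single_index (by simp)]
  have hmem : ∀ m ∈ W.support, m = m₁ ∨ m = m₂ := by
    intro m hm
    by_contra! hcon
    rw [Finsupp.mem_support_iff] at hm
    apply hm
    simp [hW, hcon.1.symm, hcon.2.symm]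
  let Λ : O.ReactiveStructure k :=
    { weight := W
      weight_nonneg := fun m => by
        rw [hW, Finsupp.add_apply, Finsupp.single_apply, Finsupp.single_apply]
        refine add_nonneg ?_ ?_ <;> split <;> linarith
      weight_sum := by simpa using hsum (fun _ => 1)
      rate := fun m => if m = m₁ then 0 else 1
      steady := fun m => if m = m₁ then O.stickySteady k ν ρ hρ1.le (fun t => (hρ t).le)
        else O.stickySteady k (Assignment.pure g) 0 zero_le_one hp
      isSteady := fun m hm => by
        rcases hmem m hm with rfl | rfl
        · rw [if_pos rfl]; exact O.isSteady_stickySteady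
        · rw [if_neg hne]; exact O.isSteady_stickySteady }
  refine ⟨Λ, ⟨fun m hm => ?_, fun t => ?_⟩, ?_⟩
  · rcases hmem m hm with rfl | rfl
    · exact respects_stickyAssignment obs
    · exact respects_stickyAssignment obs
  · rw [← hq t, ← hpure]
    refine (hsum _).trans ?_
    simp only [Λ, if_true, if_neg hne, sum_stickySteady_task]
  · refine (hsum _).trans ?_
    simp only [Λ, if_true, if_neg hne]
    rw [O.reactiveTeam_socialValue_of_rate_one, hm₁, O.reactiveTeam_socialValue hd]
    ring

end Organization

/-! ### Perturbing the correlation, then the task share. -/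

open Filter Topology in
/-- Correlation between successive tasks leaves room for a larger share of the task with less
surplus. Here `u` and `v` are the surpluses of the two tasks, `d` and `e` the temptations, and
`p` is the share of the first task at which the larger temptation binds. -/
lemma exists_slack {δ u v d e p η : ℝ} (hδ0 : 0 < δ) (hδ1 : δ < 1) (huv : u < v) (hp0 : 0 < p)
    (hp1 : p < 1) (hde : d ≠ e) (hbind : max d e = δ / (1 - δ) * (p * u + (1 - p) * v))
    (hη : p < η) :
    ∃ p' ρ : ℝ, p < p' ∧ p' < η ∧ p' < 1 ∧ ρ < 1 ∧ 0 < (1 - ρ) * p' + ρ ∧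
      0 < (1 - ρ) * (1 - p') + ρ ∧
      d < δ / (1 - δ) * (p' * u + (1 - p') * v) +
        δ * ρ / (1 - δ * ρ) * (u - (p' * u + (1 - p') * v)) ∧
      e < δ / (1 - δ) * (p' * u + (1 - p') * v) +
        δ * ρ / (1 - δ * ρ) * (v - (p' * u + (1 - p') * v)) := by
  set W : ℝ → ℝ → ℝ → ℝ := fun x p' ρ => δ / (1 - δ) * (p' * u + (1 - p') * v) +
    δ * ρ / (1 - δ * ρ) * (x - (p' * u + (1 - p') * v)) with hW
  have hcρ : ∀ x, ContinuousAt (fun ρ => W x p ρ) 0 := fun x => by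
    have : (1 : ℝ) - δ * 0 ≠ 0 := by norm_num
    simp only [hW]
    fun_prop (disch := assumption)
  have hW0 : ∀ x, W x p 0 = max d e := fun x => by simp [hW, hbind]
  have hposκ : ∀ ρ, 0 < ρ → ρ < 1 → 0 < δ * ρ / (1 - δ * ρ) := fun ρ h0 h1 =>
    div_pos (mul_pos hδ0 h0) (by nlinarith)
  have hnegκ : ∀ ρ, ρ < 0 → δ * ρ / (1 - δ * ρ) < 0 := fun ρ h0 =>
    div_neg_of_neg_of_pos (mul_neg_of_pos_of_neg hδ0 h0) (by nlinarith)
  -- At `ρ = 0` the conditions reduce to `0 < p < 1`, so small correlations of either sign are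
  -- admissible.
  have hrange : ∀ᶠ ρ : ℝ in 𝓝 0, ρ < 1 ∧ 0 < (1 - ρ) * p + ρ ∧ 0 < (1 - ρ) * (1 - p) + ρ := by
    have h1 : ContinuousAt (fun ρ : ℝ => (1 - ρ) * p + ρ) 0 := by fun_prop
    have h2 : ContinuousAt (fun ρ : ℝ => (1 - ρ) * (1 - p) + ρ) 0 := by fun_prop
    filter_upwards [gt_mem_nhds zero_lt_one, h1.eventually (lt_mem_nhds (a := 0) (by simpa using hp0)),
      h2.eventually (lt_mem_nhds (a := 0) (by simpa using hp1))] with ρ ha hb hc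
    exact ⟨ha, hb, hc⟩
  obtain ⟨ρ, ⟨hρ1, hρp, hρq⟩, hd, he⟩ : ∃ ρ : ℝ,
      (ρ < 1 ∧ 0 < (1 - ρ) * p + ρ ∧ 0 < (1 - ρ) * (1 - p) + ρ) ∧ d < W u p ρ ∧ e < W v p ρ := by
    -- If `e` binds, a small `ρ > 0` raises the prospect after the task with above-average surplus
    -- `v`; if `d` binds, a small `ρ < 0` raises it after the task with surplus `u`. The other
    -- constraint is slack and survives by continuity.
    rcases lt_or_gt_of_ne hde with h | h
    · rw [max_eq_right h.le] at hW0 hbind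
      have h1 := (hcρ u).eventually (lt_mem_nhds (h.trans_eq (hW0 _).symm))
      have h2 : ∀ᶠ ρ : ℝ in 𝓝[>] 0, 0 < ρ := self_mem_nhdsWithin
      obtain ⟨ρ, ⟨h3, h4⟩, h5⟩ :=
        (((hrange.and h1).filter_mono nhdsWithin_le_nhds).and h2).exists
      refine ⟨ρ, h3, h4, ?_⟩
      have : 0 < v - (p * u + (1 - p) * v) := by nlinarith
      simp only [hW]
      rw [← hbind]
      linarith [mul_pos (hposκ ρ h5 h3.1) this]
    · rw [max_eq_left h.le] at hW0 hbind
      have h1 := (hcρ v).eventually (lt_mem_nhds (h.trans_eq (hW0 _).symm))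
      have h2 : ∀ᶠ ρ : ℝ in 𝓝[<] 0, ρ < 0 := self_mem_nhdsWithin
      obtain ⟨ρ, ⟨h3, h4⟩, h5⟩ :=
        (((hrange.and h1).filter_mono nhdsWithin_le_nhds).and h2).exists
      refine ⟨ρ, h3, ?_, h4⟩
      have : u - (p * u + (1 - p) * v) < 0 := by nlinarith
      simp only [hW]
      rw [← hbind]
      linarith [mul_pos_of_neg_of_neg (hnegκ ρ h5) this]
  -- With `ρ` fixed, all conditions are strict at `p` and survive a small increase of the share.
  have hcp : ∀ x, ContinuousAt (fun p' => W x p' ρ) p := fun x => by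
    simp only [hW]
    fun_prop
  have h1 : ContinuousAt (fun p' : ℝ => (1 - ρ) * p' + ρ) p := by fun_prop
  have h2 : ContinuousAt (fun p' : ℝ => (1 - ρ) * (1 - p') + ρ) p := by fun_prop
  have h3 : ∀ᶠ p' : ℝ in 𝓝 p, p' < η ∧ p' < 1 ∧ 0 < (1 - ρ) * p' + ρ ∧
      0 < (1 - ρ) * (1 - p') + ρ ∧ d < W u p' ρ ∧ e < W v p' ρ := by
    filter_upwards [gt_mem_nhds hη, gt_mem_nhds hp1, h1.eventually (lt_mem_nhds hρp),
      h2.eventually (lt_mem_nhds hρq), (hcp u).eventually (lt_mem_nhds hd),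
      (hcp v).eventually (lt_mem_nhds he)] with p' a b c d e f
    exact ⟨a, b, c, d, e, f⟩
  have h4 : ∀ᶠ p' : ℝ in 𝓝[>] p, p < p' := self_mem_nhdsWithin
  obtain ⟨p', ⟨ha, hb, hc, hd', he', hf⟩, hpp⟩ := ((h3.filter_mono nhdsWithin_le_nhds).and h4).exists
  exact ⟨p', ρ, hpp, ha, hb, hρ1, hc, hd', he', hf⟩

/-! ### The static benchmark and the comparison. -/

namespace Organization

variable {n : ℕ} (O : Organization n)

/-- The value of a static structure in which only teams with assignment `ν` cooperate. -/
lemma staticValue_of_support [NeZero n] {ν : Assignment} {g : Game} {lam : StaticStructure}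
    (hν : ∀ t, ν t < 1)
    (hd : ∀ t, O.d t ≤ O.δ / (1 - O.δ) * ∑ t', ν t' * O.surplus t')
    (hmass : 0 < lam.weight ν)
    (hsupp : ∀ ν' ∈ lam.weight.support,
      (ν' = ν ∧ (lam.rate ν' : ℝ) = 0) ∨
      (ν' = Assignment.pure g ∧ (O.staticTeam ν' (lam.rate ν')).PrecludesCooperation)) :
    O.staticValue lam = lam.weight ν * ∑ t, ν t * (O.a t * O.V t) ∧ lam.weight ν ≤ 1 ∧
      ∀ t, ∑ ν' ∈ lam.weight.support, lam.weight ν' * ν' t =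
        lam.weight ν * ν t + (1 - lam.weight ν) * (if t = g then 1 else 0) := by
  classical
  have hpure : ∀ t, Assignment.pure g t = if t = g then 1 else 0 := fun t => by
    change (Pi.single g (1 : ℝ) : Game → ℝ) t = _
    rw [Pi.single_apply]
  have hne : ν ≠ Assignment.pure g := by
    intro h
    have := hν g
    rw [h, hpure] at this
    simp at this
  have hsum : ∀ F : Assignment → ℝ, ∑ ν' ∈ lam.weight.support, lam.weight ν' * F ν' =
      lam.weight ν * F ν + lam.weight (Assignment.pure g) * F (Assignment.pure g) := by
    intro F
    rw [← Finset.sum_pair (f := fun ν' => lam.weight ν' * F ν') hne]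
    refine Finset.sum_subset (fun ν' h => ?_) (fun ν' _ h => ?_)
    · rcases hsupp ν' h with h | h <;> simp [h.1]
    · rw [Finsupp.notMem_support_iff.1 h, zero_mul]
  have hone : lam.weight ν + lam.weight (Assignment.pure g) = 1 := by
    have h := hsum (fun _ => 1)
    simp only [mul_one] at h
    rw [← h, lam.weight_sum]
  have hrate : (lam.rate ν : ℝ) = 0 :=
    ((hsupp ν (Finsupp.mem_support_iff.2 hmass.ne')).resolve_right fun h => hne h.1).2
  refine ⟨?_, by linarith [lam.weight_nonneg (Assignment.pure g)], fun t => ?_⟩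
  · rw [staticValue, hsum fun ν' => (O.staticTeam ν' (lam.rate ν')).socialValue O.V,
      O.staticTeam_socialValue hrate hd]
    -- Outside the support `hsupp` says nothing about the reshuffling rate, but there the weight is
    -- zero.
    by_cases h0 : lam.weight (Assignment.pure g) = 0
    · rw [h0, zero_mul, add_zero]
    · rw [TeamGame.socialValue_of_precludesCooperation, mul_zero, add_zero]
      exact ((hsupp _ (Finsupp.mem_support_iff.2 h0)).resolve_left fun h => hne h.1.symm).2
  · rw [hsum fun ν' => ν' t, hpure, ← hone]
    ring

end Organization

theorem proposition3 (n : ℕ) [NeZero n] (O : Organization n)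
    (hG : O.δ / (1 - O.δ) * (O.a Game.good * O.c Game.good) < O.d Game.good)
    (hB : max (O.d Game.good) (O.d Game.bad) <
      O.δ / (1 - O.δ) * (O.a Game.bad * O.c Game.bad))
    (νcoop : Assignment)
    (hcoop : max (O.d Game.good) (O.d Game.bad) =
      O.δ / (1 - O.δ) * (νcoop Game.good * (O.a Game.good * O.c Game.good) +
        (1 - νcoop Game.good) * (O.a Game.bad * O.c Game.bad)))
    (g : Game) (lam : StaticStructure) (hopt : O.StaticOptimal lam)
    (hmass : 0 < lam.weight νcoop)
    (hsupp : ∀ ν ∈ lam.weight.support,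
      (ν = νcoop ∧ (lam.rate ν : ℝ) = 0) ∨
      (ν = Assignment.pure g ∧ (O.staticTeam ν (lam.rate ν)).PrecludesCooperation))
    (hd : O.d Game.good ≠ O.d Game.bad)
    (k : ℕ) (obs : Option Game → Option Game) :
    (∃ Λ : O.ReactiveStructure k, O.ReactiveFeasible obs Λ ∧
      ∀ lam' : StaticStructure, O.StaticFeasible lam' →
        O.staticValue lam' < O.reactiveValue Λ) ∧
    (∀ Λ : O.ReactiveStructure k, O.ReactiveOptimal obs Λ →
      ∀ lam' : StaticStructure, O.StaticOptimal lam' →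
        O.staticValue lam' < O.reactiveValue Λ) := by
  suffices h : ∃ Λ : O.ReactiveStructure k, O.ReactiveFeasible obs Λ ∧
      O.staticValue lam < O.reactiveValue Λ by
    obtain ⟨Λ, hΛ, hlt⟩ := h
    exact ⟨⟨Λ, hΛ, fun lam' h' => (hopt.2 lam' h').trans_lt hlt⟩, fun Λ' hΛ' lam' h' =>
      ((hopt.2 lam' h'.1).trans_lt hlt).trans_le (hΛ'.2 Λ hΛ)⟩
  have hbad : νcoop Game.bad = 1 - νcoop Game.good := by
    have := stdSimplex.sum_eq_one νcoop
    rw [Game.sum_eq] at this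
    linarith
  set p := νcoop Game.good with hp
  set w := lam.weight νcoop with hw
  have hδ0 := O.δ_pos
  have hδ1 := O.δ_lt_one
  have hκ : 0 < O.δ / (1 - O.δ) := div_pos hδ0 (by linarith)
  -- The larger temptation lies strictly between the discounted surpluses of the two tasks, by `hG`
  -- and `hB`.
  have huv : O.a Game.good * O.c Game.good < O.a Game.bad * O.c Game.bad := by
    have := (hG.trans_le (le_max_left _ _)).trans hB
    exact lt_of_mul_lt_mul_left this hκ.le
  have hp0 : 0 < p := by
    refine lt_of_le_of_ne (stdSimplex.zero_le _ _) fun h0 => ?_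
    rw [← h0] at hcoop
    simp only [zero_mul, sub_zero, one_mul, zero_add] at hcoop
    exact hB.ne hcoop
  have hp1 : p < 1 := by
    refine lt_of_le_of_ne (stdSimplex.le_one _ _) fun h1 => ?_
    rw [h1] at hcoop
    simp only [one_mul, sub_self, zero_mul, add_zero] at hcoop
    exact (hG.trans_le (le_max_left _ _)).ne hcoop.symm
  have hmean : max (O.d Game.good) (O.d Game.bad) =
      O.δ / (1 - O.δ) * ∑ t, νcoop t * O.surplus t := by
    rw [hcoop, Game.sum_eq, hbad]
    rfl
  obtain ⟨hval, hw1, hshare⟩ := O.staticValue_of_support (ν := νcoop) (g := g) (lam := lam)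
    (fun t => by cases t; exacts [hp1, by rw [hbad]; linarith])
    (fun t => by rw [← hmean]; cases t; exacts [le_max_left _ _, le_max_right _ _]) hmass hsupp
  have hq : ∀ t, w * νcoop t + (1 - w) * (if t = g then 1 else 0) = O.q t := fun t => by
    rw [← hshare, hopt.1 t]
  have hVG := mul_pos (O.a_pos Game.good) O.V_good_pos
  have hVB := mul_neg_of_pos_of_neg (O.a_pos Game.bad) O.V_bad_neg
  rw [Game.sum_eq, hbad, ← hp] at hval
  -- Teams that cooperate on a larger share `p'` of good tasks.
  have main : ∀ η, p < η → ∃ p', p < p' ∧ p' < η ∧ p' < 1 ∧ ∀ (w' : ℝ) (g' : Game),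
      0 ≤ w' → w' ≤ 1 → w' * p' + (1 - w') * (if Game.good = g' then 1 else 0) = O.q Game.good →
      ∃ Λ : O.ReactiveStructure k, O.ReactiveFeasible obs Λ ∧ O.reactiveValue Λ =
        w' * (p' * (O.a Game.good * O.V Game.good) +
          (1 - p') * (O.a Game.bad * O.V Game.bad)) := by
    intro η hη
    obtain ⟨p', ρ, h1, h2, h3, h4, h5, h6, h7, h8⟩ :=
      exists_slack hδ0 hδ1 huv hp0 hp1 hd hcoop hη
    refine ⟨p', h1, h2, h3, fun w' g' hw0 hw1 hqg => ?_⟩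
    let ν : Assignment := ⟨fun t => if t = Game.good then p' else 1 - p',
      fun t => by dsimp only; split <;> linarith, by simp [Game.sum_eq]⟩
    have hνG : ν Game.good = p' := rfl
    have hνB : ν Game.bad = 1 - p' := rfl
    have hqsum := O.q_sum
    rw [Game.sum_eq] at hqsum
    obtain ⟨Λ, hΛ, hv⟩ := O.exists_reactiveStructure (ν := ν) h4
      (fun t => by cases t; exacts [hp0.trans h1, by rw [hνB]; linarith])
      (fun t => by cases t; exacts [h5, h6])
      (fun t => by
        rw [Organization.prospect, Game.sum_eq, hνG, hνB]
        cases t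
        exacts [h7.le, h8.le]) hw0 hw1 g'
      (fun t => by
        cases t
        · exact hqg
        · rw [hνB, ← sub_eq_of_eq_add' hqsum.symm, ← hqg]
          cases g' <;> simp <;> ring) k obs
    refine ⟨Λ, hΛ, ?_⟩
    rw [hv, Game.sum_eq, hνG, hνB]
  have hqG := hq Game.good
  -- Are there idle teams on the good task that can be drawn into cooperation?
  by_cases hcase : g = Game.good ∧ w < 1
  · obtain ⟨rfl, hlt⟩ := hcase
    simp only [if_true] at hqG
    rw [← hp] at hqG
    -- The bound on `p'` makes the new share `w * (1 - p) / (1 - p')`, which keeps the cooperating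
    -- mass on the bad task constant, less than one.
    obtain ⟨p', h1, h2, h3, hΛ⟩ := main (1 - w * (1 - p)) (by nlinarith)
    have hp' : 0 < 1 - p' := by linarith
    have hw' : w * (1 - p) / (1 - p') * (1 - p') = w * (1 - p) := div_mul_cancel₀ _ hp'.ne'
    have hww : w < w * (1 - p) / (1 - p') := by
      rw [lt_div_iff₀ hp']
      nlinarith
    generalize w * (1 - p) / (1 - p') = w' at hw' hww
    obtain ⟨Λ, hf, hv⟩ := hΛ w' Game.good (by linarith) (by nlinarith) (by
      rw [← hqG]; simp only [if_true]; linarith)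
    refine ⟨Λ, hf, ?_⟩
    rw [hv, hval]
    have : w * p < w' * p' := by linarith
    nlinarith
  -- Either the idle teams are on the bad task or there are none; in both cases only cooperating
  -- teams work on the good task.
  · have hqG' : O.q Game.good = w * p := by
      rw [← hqG, ← hp]
      by_cases hg : g = Game.good
      · have : w = 1 := le_antisymm hw1 (not_lt.1 fun h => hcase ⟨hg, h⟩)
        rw [this]
        ring
      · rw [if_neg (Ne.symm hg)]
        ring
    obtain ⟨p', h1, h2, h3, hΛ⟩ := main 1 hp1
    have hp' : 0 < p' := hp0.trans h1
    have hw' : w * p / p' * p' = w * p := div_mul_cancel₀ _ hp'.ne'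
    have hww : w * p / p' < w := by
      rw [div_lt_iff₀ hp']
      nlinarith
    have hw0 : 0 < w * p / p' := by positivity
    generalize w * p / p' = w' at hw' hww hw0
    -- Teams released from cooperation go to the bad task. The cooperating mass on the good task
    -- stays `w * p`, and that on the bad task falls from `w - w * p` to `w' - w * p`.
    obtain ⟨Λ, hf, hv⟩ := hΛ w' Game.bad hw0.le (by linarith) (by
      rw [hqG']; simpa using hw')
    refine ⟨Λ, hf, ?_⟩
    rw [hv, hval]
    nlinarith
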